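/- Setting. A cell-free massive MIMO downlink has $M$ access points with $N\ge 1$ antennas each, $K$ single-antenna users, large-scale fading coefficients $\beta_{mk}>0$, power control coefficients $\eta_{mk}\ge 0$, powers $\rho_p,\rho_d>0$, and $l_p$ orthogonal pilots of length $l_p$; $\mathcal P_k\ni k$ is the set of users with the pilot of user $k$. Put $c_{mk}=\dfrac{l_p\rho_p\beta_{mk}^2}{l_p\rho_p\sum_{k_1\in\mathcal P_k}\beta_{mk_1}+1}$ and $a_{mkk_1}=\eta_{mk_1}c_{mk}$, $d_{mkk_1}=\eta_{mk_1}(\beta_{mk}-c_{mk})$. Moments under MRT precoding. For $k_1\in\mathcal P_k$ let $e_1(m)=\sqrt{N a_{mkk_1}}$, $e_2(m)=(N+1)a_{mkk_1}$, $e_3(m)=\frac{(N+1)(N+2)}{\sqrt N}a_{mkk_1}^{3/2}$, $e_4(m)=\frac{(N+1)(N+2)(N+3)}{N}a_{mkk_1}^2$ and, with sums over pairwise distinct access points, $$u_{kk_1}=\sum_m e_2(m)+\sum_{m,m_1}e_1(m)e_1(m_1),$$ $$u^{(2)}_{kk_1}=\sum_m e_4(m)+6\sum_{m,m_1,m_2}e_2(m)e_1(m_1)e_1(m_2)+4\sum_{m,m_1}e_3(m)e_1(m_1)+3\sum_{m,m_1}e_2(m)e_2(m_1)+\sum_{m,m_1,m_2,m_3}e_1(m)e_1(m_1)e_1(m_2)e_1(m_3).$$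 For $k_1\notin\mathcal P_k$ let $u_{kk_1}=\sum_m a_{mkk_1}$, $u^{(2)}_{kk_1}=\frac{2(N+1)}N\sum_m a_{mkk_1}^2+2\sum_{m\ne m_1}a_{mkk_1}a_{m_1kk_1}$. For all $k_1$ let $w_{kk_1}=\sum_m d_{mkk_1}$, $w^{(2)}_{kk_1}=\frac{2(N+1)}N\sum_m d_{mkk_1}^2+2\sum_{m\ne m_1}d_{mkk_1}d_{m_1kk_1}$. The desired signal of user $k$ (without the factor $\rho_d$) has first and second moments $u_{kk}$, $u^{(2)}_{kk}$; interference plus noise, its summands being treated as independent, has $$v_k=\rho_d\sum_{k_1\ne k}u_{kk_1}+\rho_d\sum_{k_1}w_{kk_1}+1,$$ $$v_k^{(2)}=\rho_d^2\Big(\sum_{k_1\ne k}u^{(2)}_{kk_1}+\sum_{k_1\neq k}\sum_{k_2\ne k,k_1}u_{kk_1}u_{kk_2}+\sum_{k_1}w^{(2)}_{kk_1}+\sum_{k_1}\sum_{k_2\neq k_1}w_{kk_1}w_{kk_2}+2\sum_{k_1\ne k}u_{kk_1}\sum_{k_1}w_{kk_1}\Big)+2\rho_d\Big(\sum_{k_1\ne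 k}u_{kk_1}+\sum_{k_1}w_{kk_1}\Big)+2 .$$ The moment-matched Gamma parameters are $j_{k1}=\frac{u_{kk}^2}{u^{(2)}_{kk}-u_{kk}^2}$, $\chi_{k1}=\frac{u^{(2)}_{kk}-u_{kk}^2}{u_{kk}}$, $j_{k2}=\frac{v_k^2}{v^{(2)}_k-v_k^2}$, $\chi_{k2}=\frac{v^{(2)}_k-v_k^2}{v_k}$, and the achievable rate is $R_k=\int_0^\infty\log_2(1+x)f_{\gamma_k}(x)\,dx$ with the SINR density $$f_{\gamma_k}(x)=\frac{\Gamma(j_{k1}+j_{k2})\,x^{j_{k1}-1}\big(\frac1{\chi_{k2}}+\frac{x}{\rho_d\chi_{k1}}\big)^{-j_{k1}-j_{k2}}}{\Gamma(j_{k1})\Gamma(j_{k2})(\rho_d\chi_{k1})^{j_{k1}}\chi_{k2}^{j_{k2}}},\qquad x>0.$$ Claim. If $\eta_{mk}>0$ for some $m$, then $j_{k1},\chi_{k1},j_{k2},\chi_{k2}>0$, and if moreover $j_{k2}$ is not an integer and $\rho_d\chi_{k1}\ne\chi_{k2}$, then $$R_k=\frac{\pi\csc(j_{k2}\pi)}{\Gamma(j_{k1})\Gamma(j_{k2})\ln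 2}\left(\frac{(\rho_d\chi_{k1})^{j_{k2}}\,\Gamma(j_{k1}+j_{k2})\,\Gamma(j_{k2})}{\chi_{k2}^{j_{k2}}\,\Gamma(1+j_{k2})}\,{}_2F_1\Big(j_{k2},j_{k1}+j_{k2};1+j_{k2};\tfrac{\rho_d\chi_{k1}}{\chi_{k2}}\Big)-\frac{\rho_d\chi_{k1}\Gamma(1+j_{k1})}{\chi_{k2}\Gamma(2-j_{k2})}\,{}_3F_2\Big(1,1,1+j_{k1};2,2-j_{k2};\tfrac{\rho_d\chi_{k1}}{\chi_{k2}}\Big)\right).$$ Here ${}_2F_1$ and ${}_3F_2$ are the principal branches: the analytic continuations of the hypergeometric series from the unit disc to $\mathbb C\setminus[1,\infty)$, with values on $(1,\infty)$ taken as limits from below the cut. The same identity (with these branches existing, and with the integral convergent even without the last two conditions) holds for arbitrary positive reals $\rho_d,j_{k1},\chi_{k1},j_{k2},\chi_{k2}$ with $j_{k2}\notin\mathbb Z$ and $\rho_d\chi_{k1}\ne\chi_{k2}$. -/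

import Mathlib

open MeasureTheory Filter Topology

noncomputable section

/-- A cell-free massive MIMO downlink with `M` access points of `N` antennas each, `K`
single-antenna users and `lp` mutually orthogonal pilots of length `lp`; users holding the same
pilot contaminate each other. `β m k` is the large-scale fading coefficient and `η m k` the
downlink power control coefficient between access point `m` and user `k`; `ρp`, `ρd` are the
normalized pilot and downlink powers. -/
structure CellFreeSystem (M K N lp : ℕ) where
  pilot : Fin K → Fin lp
  β : Fin M → Fin K → ℝ
  η : Fin M → Fin K → ℝ
  ρp : ℝ
  ρd : ℝ
  N_pos : 0 < N
  β_pos : ∀ m k, 0 < β m k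
  η_nonneg : ∀ m k, 0 ≤ η m k
  ρp_pos : 0 < ρp
  ρd_pos : 0 < ρd

namespace CellFreeSystem

variable {M K N lp : ℕ} (S : CellFreeSystem M K N lp)

/-- The users with the same pilot as user `k` (including `k`). -/
def copilot (k : Fin K) : Finset (Fin K) := Finset.univ.filter fun k₁ => S.pilot k₁ = S.pilot k

/-- Variance `c_{mk}` of each entry of the MMSE channel estimate. -/
def c (m : Fin M) (k : Fin K) : ℝ :=
  lp * S.ρp * S.β m k ^ 2 / (lp * S.ρp * (∑ k₁ ∈ S.copilot k, S.β m k₁) + 1)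

/-- First to fourth moments of `ξ_{mkk₁} = √η_{mk₁} ĥ_{mk}ᴴ b_{mk₁}` under maximum ratio
transmission, for users `k`, `k₁` with the same pilot (in particular for `k₁ = k`, where it is
`ξ_{mk}`): it is then a Gamma variable of shape `N` and scale `√(η_{mk₁} c_{mk} / N)`. -/
def ξ1 (k k₁ : Fin K) (m : Fin M) : ℝ := Real.sqrt (N * S.η m k₁ * S.c m k)

/-- See `ξ1`. -/
def ξ2 (k k₁ : Fin K) (m : Fin M) : ℝ := (N + 1) * S.η m k₁ * S.c m k

/-- See `ξ1`. -/
def ξ3 (k k₁ : Fin K) (m : Fin M) : ℝ :=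
  (N + 1) * (N + 2) / Real.sqrt N * S.η m k₁ ^ (3 / 2 : ℝ) * S.c m k ^ (3 / 2 : ℝ)

/-- See `ξ1`. -/
def ξ4 (k k₁ : Fin K) (m : Fin M) : ℝ :=
  (N + 1) * (N + 2) * (N + 3) / N * S.η m k₁ ^ 2 * S.c m k ^ 2

/-- First moment of `|∑ₘ Xₘ|²` for independent real variables `Xₘ` with moments `e1, e2`. -/
def sqSumMoment1 (e1 e2 : Fin M → ℝ) : ℝ :=
  ∑ m, e2 m + ∑ m, ∑ m₁ with m₁ ≠ m, e1 m * e1 m₁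

/-- Second moment of `|∑ₘ Xₘ|²` for independent real variables `Xₘ` with moments
`e1, e2, e3, e4`. -/
def sqSumMoment2 (e1 e2 e3 e4 : Fin M → ℝ) : ℝ :=
  ∑ m, e4 m
    + ∑ m, ∑ m₁ with m₁ ≠ m, ∑ m₂ with m₂ ≠ m ∧ m₂ ≠ m₁, 6 * (e2 m * e1 m₁ * e1 m₂)
    + ∑ m, ∑ m₁ with m₁ ≠ m, 4 * (e3 m * e1 m₁)
    + ∑ m, ∑ m₁ with m₁ ≠ m, 3 * (e2 m * e2 m₁)
    + ∑ m, ∑ m₁ with m₁ ≠ m, ∑ m₂ with m₂ ≠ m ∧ m₂ ≠ m₁,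
        ∑ m₃ with m₃ ≠ m ∧ m₃ ≠ m₁ ∧ m₃ ≠ m₂, e1 m * e1 m₁ * e1 m₂ * e1 m₃

/-- First moment of `|∑ₘ Xₘ|²` for independent circularly symmetric complex variables `Xₘ` with
`E|Xₘ|² = a m`. -/
def circMoment1 (a : Fin M → ℝ) : ℝ := ∑ m, a m

/-- Second moment of `|∑ₘ Xₘ|²` for independent circularly symmetric complex variables `Xₘ` with
`E|Xₘ|² = a m` and `E|Xₘ|⁴ = d m`. -/
def circMoment2 (a d : Fin M → ℝ) : ℝ :=
  ∑ m, d m + 2 * ∑ m, ∑ m₁ with m₁ ≠ m, a m * a m₁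

/-- `E{U_k^1}`, with `U_k^1 = |∑ₘ √η_{mk} ĥ_{mk}ᴴ b_{mk}|²`. -/
def meanU1 (k : Fin K) : ℝ := sqSumMoment1 (S.ξ1 k k) (S.ξ2 k k)

/-- `E{(U_k^1)²}`. -/
def secondU1 (k : Fin K) : ℝ := sqSumMoment2 (S.ξ1 k k) (S.ξ2 k k) (S.ξ3 k k) (S.ξ4 k k)

/-- `E{U_{kk₁}^2}`, with `U_{kk₁}^2 = |∑ₘ √η_{mk₁} ĥ_{mk}ᴴ b_{mk₁}|²`. -/
def meanU2 (k k₁ : Fin K) : ℝ :=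
  if S.pilot k₁ = S.pilot k then sqSumMoment1 (S.ξ1 k k₁) (S.ξ2 k k₁)
  else circMoment1 fun m => S.η m k₁ * S.c m k

/-- `E{(U_{kk₁}^2)²}`. -/
def secondU2 (k k₁ : Fin K) : ℝ :=
  if S.pilot k₁ = S.pilot k then
    sqSumMoment2 (S.ξ1 k k₁) (S.ξ2 k k₁) (S.ξ3 k k₁) (S.ξ4 k k₁)
  else circMoment2 (fun m => S.η m k₁ * S.c m k)
    (fun m => 2 * (N + 1) / N * S.η m k₁ ^ 2 * S.c m k ^ 2)

/-- `E{U_{kk₁}^3}`, with `U_{kk₁}^3 = |∑ₘ √η_{mk₁} h̄_{mk}ᴴ b_{mk₁}|²`, where `h̄_{mk}` is the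
channel estimation error. -/
def meanU3 (k k₁ : Fin K) : ℝ := circMoment1 fun m => S.η m k₁ * (S.β m k - S.c m k)

/-- `E{(U_{kk₁}^3)²}`. -/
def secondU3 (k k₁ : Fin K) : ℝ :=
  circMoment2 (fun m => S.η m k₁ * (S.β m k - S.c m k))
    (fun m => 2 * (N + 1) / N * S.η m k₁ ^ 2 * (S.β m k - S.c m k) ^ 2)

/-- First moment of the interference plus noise
`IN_k = ρd ∑_{k₁ ≠ k} U_{kk₁}^2 + ρd ∑_{k₁} U_{kk₁}^3 + noise power`. -/
def meanIN (k : Fin K) : ℝ :=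
  S.ρd * ∑ k₁ with k₁ ≠ k, S.meanU2 k k₁ + S.ρd * ∑ k₁, S.meanU3 k k₁ + 1

/-- Second moment of the interference plus noise, the summands being treated as independent. The
noise power `|z|²`, `z` standard complex Gaussian, has mean `1` and second moment `2`. -/
def secondIN (k : Fin K) : ℝ :=
  S.ρd ^ 2 *
      (∑ k₁ with k₁ ≠ k, S.secondU2 k k₁
        + ∑ k₁ with k₁ ≠ k, ∑ k₂ with k₂ ≠ k ∧ k₂ ≠ k₁, S.meanU2 k k₁ * S.meanU2 k k₂
        + ∑ k₁, S.secondU3 k k₁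
        + ∑ k₁, ∑ k₂ with k₂ ≠ k₁, S.meanU3 k k₁ * S.meanU3 k k₂
        + 2 * (∑ k₁ with k₁ ≠ k, S.meanU2 k k₁) * (∑ k₁, S.meanU3 k k₁))
    + 2 * S.ρd * (∑ k₁ with k₁ ≠ k, S.meanU2 k k₁ + ∑ k₁, S.meanU3 k k₁)
    + 2

/-- Shape of the Gamma distribution with first moment `u` and second moment `v`. -/
def gammaShape (u v : ℝ) : ℝ := u ^ 2 / (v - u ^ 2)

/-- Scale of the Gamma distribution with first moment `u` and second moment `v`. -/
def gammaScale (u v : ℝ) : ℝ := (v - u ^ 2) / u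

/-- Shape `j_{k1}` of the Gamma law of `U_k^1`. -/
def j1 (k : Fin K) : ℝ := gammaShape (S.meanU1 k) (S.secondU1 k)

/-- Scale `χ_{k1}` of the Gamma law of `U_k^1`. -/
def χ1 (k : Fin K) : ℝ := gammaScale (S.meanU1 k) (S.secondU1 k)

/-- Shape `j_{k2}` of the Gamma law of the interference plus noise. -/
def j2 (k : Fin K) : ℝ := gammaShape (S.meanIN k) (S.secondIN k)

/-- Scale `χ_{k2}` of the Gamma law of the interference plus noise. -/
def χ2 (k : Fin K) : ℝ := gammaScale (S.meanIN k) (S.secondIN k)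

end CellFreeSystem

/-- Density on `(0, ∞)` of the SINR, the quotient of independent Gamma variables with shape and
scale `(j₁, ρ χ₁)` and `(j₂, χ₂)`. -/
def sinrPDF (ρ j₁ χ₁ j₂ χ₂ x : ℝ) : ℝ :=
  Real.Gamma (j₁ + j₂) * x ^ (j₁ - 1) * (1 / χ₂ + x / (ρ * χ₁)) ^ (-j₁ - j₂)
    / (Real.Gamma j₁ * Real.Gamma j₂ * (ρ * χ₁) ^ j₁ * χ₂ ^ j₂)

/-- The achievable rate `∫₀^∞ log₂(1 + x) f(x) dx`. -/
def achievableRate (ρ j₁ χ₁ j₂ χ₂ : ℝ) : ℝ :=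
  ∫ x in Set.Ioi (0 : ℝ), Real.logb 2 (1 + x) * sinrPDF ρ j₁ χ₁ j₂ χ₂ x

/-- The series `∑ₙ (a₁)ₙ⋯(a_p)ₙ / ((b₁)ₙ⋯(b_q)ₙ) zⁿ / n!` of the generalized hypergeometric
function `pFq(a; b; z)`. -/
def hypSeries (a b : List ℂ) (z : ℂ) : ℂ :=
  ∑' n : ℕ, (a.map fun t => (ascPochhammer ℂ n).eval t).prod
    / (b.map fun t => (ascPochhammer ℂ n).eval t).prod * z ^ n / (n.factorial : ℂ)

/-- `F` is the principal branch of the function given on the unit disc by the convergent power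
series `f`: it is holomorphic off the cut `[1, ∞)`, equal to `f` on the unit disc, and its values
on `(1, ∞)` are the limits from below the cut. Its value at the branch point `1` is not
constrained. -/
structure IsPrincipalBranch (f F : ℂ → ℂ) : Prop where
  holo : DifferentiableOn ℂ F {z : ℂ | ¬ (z.im = 0 ∧ 1 ≤ z.re)}
  eq_disc : ∀ z : ℂ, ‖z‖ < 1 → F z = f z
  below : ∀ x : ℝ, 1 < x → Tendsto F (𝓝[{z : ℂ | z.im < 0}] (x : ℂ)) (𝓝 (F x))

open Classical in
/-- The principal branch of the function given by `f` on the unit disc (`f` itself if there is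
none). -/
def principalBranch (f : ℂ → ℂ) : ℂ → ℂ :=
  if h : ∃ F, IsPrincipalBranch f F then h.choose else f

/-- Gauss's hypergeometric function, principal branch. -/
def gaussHyp (a b c : ℂ) : ℂ → ℂ := principalBranch (ordinaryHypergeometric a b c)

/-- The generalized hypergeometric function, principal branch. -/
def genHyp (a b : List ℂ) : ℂ → ℂ := principalBranch (hypSeries a b)

/-- The closed form of the achievable rate. -/
def rateClosedForm (ρ j₁ χ₁ j₂ χ₂ : ℝ) : ℂ :=
  ((Real.pi * (Real.sin (j₂ * Real.pi))⁻¹ / (Real.Gamma j₁ * Real.Gamma j₂ * Real.log 2) : ℝ) : ℂ)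
    * ((((ρ * χ₁) ^ j₂ * Real.Gamma (j₁ + j₂) * Real.Gamma j₂
            / (χ₂ ^ j₂ * Real.Gamma (1 + j₂)) : ℝ) : ℂ)
          * gaussHyp j₂ (j₁ + j₂) (1 + j₂) ((ρ * χ₁ / χ₂ : ℝ) : ℂ)
        - ((ρ * χ₁ * Real.Gamma (1 + j₁) / (χ₂ * Real.Gamma (2 - j₂)) : ℝ) : ℂ)
          * genHyp [1, 1, 1 + j₁] [2, 2 - j₂] ((ρ * χ₁ / χ₂ : ℝ) : ℂ))

end

/-! Positivity of the Gamma parameters says that both matched laws have positive mean and variance.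
Expanding `sqSumMoment2 - sqSumMoment1 ^ 2` gives a sum of covariances, each nonnegative by the
elementary inequalities between the moments (`sqSumMoment2_eq`, `sum_sq_le_sqSumMoment2_sub`);
strictness comes from an active access point for the signal and from the noise for the interference.

For the rate write $a=j_1$, $b=j_2$, $\theta=\rho\chi_1/\chi_2$. The substitution $x=\theta t/(1-t)$
turns the rate into a constant times $L(1-\theta)-L(1)$, where
$L(z)=\int_0^1t^{a-1}(1-t)^{b-1}\log(1-tz)\,dt$ (`rate_change_of_variables`). Here $L'=-K$ with $K$
a multiple of ${}_2F_1(1,1+a;1+a+b;\cdot)$ (`exists_stieltjes`).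

A hypergeometric function ${}_2F_1$ with a numerator parameter 1 solves a first order inhomogeneous
linear equation (`deriv_eq_of_coeff_ratio`). Both $K(1-z)$ and $H(z)={}_2F_1(1,1+a;2-b;z)$ do so,
with the same homogeneous part and proportional constant terms. Hence
$K(1-z)+A\,H(z)=C\,z^{b-1}(1-z)^{-a-b}$ for suitable constants, and $C$ is read off from the
singularity of $H$ at 1 (`connection_formula`). The reflection formula identifies it as $\pi/\sin\pi
b$ (`gamma_connection_constant`).

Integrating from 0, $H$ is the derivative of $z\,{}_3F_2$ and the power product is that of
$z^b\,{}_2F_1/b$, while the integration constant $L(1)$ cancels in the rate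
(`integral_log_eq_of_branches`). This settles $\theta<1$. For $\theta>1$ one lets $z\to\theta$ from
the lower half-plane: $L(1-z)$ is regular there and the principal branches take their lower limits
(`integral_log_eq_principalBranch`). Existence of these limits also comes from the differential
equations. -/

namespace CellFreeSystem

/-! ### Moments of the signal and of the interference; positivity of the Gamma parameters. -/

theorem sum_ne_eq {M : ℕ} (f : Fin M → ℝ) (m : Fin M) :
    ∑ i with i ≠ m, f i = ∑ i, f i - f m := by
  rw [Finset.filter_ne', Finset.sum_erase_eq_sub (Finset.mem_univ m)]

theorem sum_ne_ne_eq {M : ℕ} (f : Fin M → ℝ) {m m₁ : Fin M} (h : m₁ ≠ m) :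
    ∑ i with i ≠ m ∧ i ≠ m₁, f i = ∑ i, f i - f m - f m₁ := by
  rw [← Finset.filter_filter, Finset.filter_ne', Finset.filter_ne',
    Finset.sum_erase_eq_sub (by simp [h]), Finset.sum_erase_eq_sub (Finset.mem_univ m)]

theorem sum_ne_ne_ne_eq {M : ℕ} (f : Fin M → ℝ) {m m₁ m₂ : Fin M} (h : m₁ ≠ m)
    (h₂ : m₂ ≠ m ∧ m₂ ≠ m₁) :
    ∑ i with i ≠ m ∧ i ≠ m₁ ∧ i ≠ m₂, f i = ∑ i, f i - f m - f m₁ - f m₂ := by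
  rw [← Finset.filter_filter, Finset.filter_ne', ← Finset.filter_filter, Finset.filter_ne',
    Finset.filter_ne', Finset.sum_erase_eq_sub (by simp [h₂.1, h₂.2]),
    Finset.sum_erase_eq_sub (by simp [h]), Finset.sum_erase_eq_sub (Finset.mem_univ m)]

theorem sum_pairs_eq {M : ℕ} (f g : Fin M → ℝ) :
    ∑ m, ∑ m₁ with m₁ ≠ m, f m * g m₁ = (∑ m, f m) * ∑ m, g m - ∑ m, f m * g m := by
  simp only [← Finset.mul_sum, sum_ne_eq, mul_sub, Finset.sum_sub_distrib, Finset.sum_mul]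

theorem sum_triples_eq {M : ℕ} (f g : Fin M → ℝ) :
    ∑ m, ∑ m₁ with m₁ ≠ m, ∑ m₂ with m₂ ≠ m ∧ m₂ ≠ m₁, f m * g m₁ * g m₂
      = (∑ m, f m) * (∑ m, g m) ^ 2 - (∑ m, f m) * ∑ m, g m ^ 2
        - 2 * (∑ m, f m * g m) * (∑ m, g m) + 2 * ∑ m, f m * g m ^ 2 := by
  have h1 : ∀ m, ∑ m₁ with m₁ ≠ m, ∑ m₂ with m₂ ≠ m ∧ m₂ ≠ m₁, f m * g m₁ * g m₂
      = f m * (∑ i, g i) ^ 2 - f m * (∑ i, g i ^ 2) - 2 * (f m * g m) * (∑ i, g i)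
        + 2 * (f m * g m ^ 2) := by
    intro m
    have h2 : ∑ m₁ with m₁ ≠ m, ∑ m₂ with m₂ ≠ m ∧ m₂ ≠ m₁, f m * g m₁ * g m₂
        = ∑ m₁ with m₁ ≠ m, (f m * (∑ i, g i - g m) * g m₁ - f m * g m₁ ^ 2) := by
      refine Finset.sum_congr rfl fun m₁ hm₁ => ?_
      rw [← Finset.mul_sum, sum_ne_ne_eq _ (by simpa using hm₁)]
      ring
    rw [h2, Finset.sum_sub_distrib, ← Finset.mul_sum, ← Finset.mul_sum, sum_ne_eq,
      sum_ne_eq (fun i => g i ^ 2)]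
    ring
  rw [Finset.sum_congr rfl fun m _ => h1 m]
  simp only [Finset.sum_add_distrib, Finset.sum_sub_distrib, ← Finset.sum_mul,
    ← Finset.mul_sum]

/-- Newton's identity for 24 times the fourth elementary symmetric function. The excluded indices
are removed from the innermost sum outwards. -/
theorem sum_quadruples_eq {M : ℕ} (g : Fin M → ℝ) :
    ∑ m, ∑ m₁ with m₁ ≠ m, ∑ m₂ with m₂ ≠ m ∧ m₂ ≠ m₁,
        ∑ m₃ with m₃ ≠ m ∧ m₃ ≠ m₁ ∧ m₃ ≠ m₂, g m * g m₁ * g m₂ * g m₃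
      = (∑ m, g m) ^ 4 - 6 * (∑ m, g m) ^ 2 * (∑ m, g m ^ 2) + 8 * (∑ m, g m) * (∑ m, g m ^ 3)
        + 3 * (∑ m, g m ^ 2) ^ 2 - 6 * ∑ m, g m ^ 4 := by
  set p := ∑ m, g m with hp
  have h1 : ∀ m, ∑ m₁ with m₁ ≠ m, ∑ m₂ with m₂ ≠ m ∧ m₂ ≠ m₁,
        ∑ m₃ with m₃ ≠ m ∧ m₃ ≠ m₁ ∧ m₃ ≠ m₂, g m * g m₁ * g m₂ * g m₃
      = ∑ m₁ with m₁ ≠ m, ∑ m₂ with m₂ ≠ m ∧ m₂ ≠ m₁,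
        ((p - g m) * (g m * g m₁ * g m₂) - g m * (g m₁ ^ 2) * g m₂ - g m * g m₁ * g m₂ ^ 2) := by
    intro m
    refine Finset.sum_congr rfl fun m₁ hm₁ => Finset.sum_congr rfl fun m₂ hm₂ => ?_
    rw [← Finset.mul_sum, sum_ne_ne_ne_eq _ (by simpa using hm₁) (by simpa using hm₂)]
    ring
  have h2 : ∀ m, ∑ m₁ with m₁ ≠ m, ∑ m₂ with m₂ ≠ m ∧ m₂ ≠ m₁,
        ((p - g m) * (g m * g m₁ * g m₂) - g m * (g m₁ ^ 2) * g m₂ - g m * g m₁ * g m₂ ^ 2)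
      = ∑ m₁ with m₁ ≠ m, (((p - g m) * g m * (p - g m) - g m * ∑ i, g i ^ 2 + g m * g m ^ 2)
          * g m₁ - (2 * (p - g m) * g m) * g m₁ ^ 2 + 2 * g m * g m₁ ^ 3) := by
    intro m
    refine Finset.sum_congr rfl fun m₁ hm₁ => ?_
    have hm : m₁ ≠ m := by simpa using hm₁
    rw [Finset.sum_sub_distrib, Finset.sum_sub_distrib, ← Finset.mul_sum, ← Finset.mul_sum,
      ← Finset.mul_sum, ← Finset.mul_sum, sum_ne_ne_eq _ hm, sum_ne_ne_eq (fun i => g i ^ 2) hm]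
    ring
  have h3 : ∀ m, ∑ m₁ with m₁ ≠ m, ∑ m₂ with m₂ ≠ m ∧ m₂ ≠ m₁,
        ∑ m₃ with m₃ ≠ m ∧ m₃ ≠ m₁ ∧ m₃ ≠ m₂, g m * g m₁ * g m₂ * g m₃
      = (p ^ 3 - 3 * p * (∑ i, g i ^ 2) + 2 * ∑ i, g i ^ 3) * g m
        + (3 * (∑ i, g i ^ 2) - 3 * p ^ 2) * g m ^ 2 + 6 * p * g m ^ 3 - 6 * g m ^ 4 := by
    intro m
    rw [h1, h2, Finset.sum_add_distrib, Finset.sum_sub_distrib, ← Finset.mul_sum,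
      ← Finset.mul_sum, ← Finset.mul_sum, sum_ne_eq, sum_ne_eq (fun i => g i ^ 2),
      sum_ne_eq (fun i => g i ^ 3)]
    ring
  rw [Finset.sum_congr rfl fun m _ => h3 m]
  simp only [Finset.sum_add_distrib, Finset.sum_sub_distrib, ← Finset.mul_sum]
  rw [← hp]
  ring

/-- The variance of $(\sum X_m)^2$ as a sum of covariances of the products $X_mX_{m'}$: each summand
isolates one pattern of coinciding indices. In this form nonnegativity is visible term by term. The
identity itself is polynomial in power sums. -/
theorem sqSumMoment2_eq {M : ℕ} (e1 e2 e3 e4 : Fin M → ℝ) :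
    sqSumMoment2 e1 e2 e3 e4 = sqSumMoment1 e1 e2 ^ 2 + (∑ m, (e4 m - e2 m ^ 2)
      + 4 * (∑ m, ∑ m₁ with m₁ ≠ m, (e3 m - e1 m * e2 m) * e1 m₁)
      + 2 * (∑ m, ∑ m₁ with m₁ ≠ m, (e2 m * e2 m₁ - e1 m ^ 2 * e1 m₁ ^ 2))
      + 4 * (∑ m, ∑ m₁ with m₁ ≠ m, ∑ m₂ with m₂ ≠ m ∧ m₂ ≠ m₁,
          (e2 m - e1 m ^ 2) * e1 m₁ * e1 m₂)) := by
  have c6 : ∑ m, ∑ m₁ with m₁ ≠ m, ∑ m₂ with m₂ ≠ m ∧ m₂ ≠ m₁, 6 * (e2 m * e1 m₁ * e1 m₂)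
      = 6 * ∑ m, ∑ m₁ with m₁ ≠ m, ∑ m₂ with m₂ ≠ m ∧ m₂ ≠ m₁, e2 m * e1 m₁ * e1 m₂ := by
    simp only [Finset.mul_sum]
  have c4 : ∑ m, ∑ m₁ with m₁ ≠ m, 4 * (e3 m * e1 m₁)
      = 4 * ∑ m, ∑ m₁ with m₁ ≠ m, e3 m * e1 m₁ := by
    simp only [Finset.mul_sum]
  have c3 : ∑ m, ∑ m₁ with m₁ ≠ m, 3 * (e2 m * e2 m₁)
      = 3 * ∑ m, ∑ m₁ with m₁ ≠ m, e2 m * e2 m₁ := by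
    simp only [Finset.mul_sum]
  rw [sqSumMoment2, sqSumMoment1, c6, c4, c3, sum_quadruples_eq, sum_triples_eq, sum_triples_eq]
  simp only [Finset.sum_sub_distrib, sum_pairs_eq (fun m => e3 m - e1 m * e2 m) e1]
  rw [sum_pairs_eq, sum_pairs_eq, sum_pairs_eq,
    sum_pairs_eq (fun m => e1 m ^ 2) fun m => e1 m ^ 2]
  simp only [sub_mul, Finset.sum_sub_distrib]
  have q1 : ∀ m, e1 m * e1 m = e1 m ^ 2 := fun m => by ring
  have q2 : ∀ m, e2 m * e2 m = e2 m ^ 2 := fun m => by ring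
  have q3 : ∀ m, e1 m ^ 2 * e1 m ^ 2 = e1 m ^ 4 := fun m => by ring
  have q6 : ∀ m, e1 m * e2 m = e2 m * e1 m := fun m => by ring
  have q4 : ∀ m, e2 m * e1 m * e1 m = e2 m * e1 m ^ 2 := fun m => by ring
  have q5 : ∀ m, e1 m ^ 2 * e1 m = e1 m ^ 3 := fun m => by ring
  simp only [q1, q2, q3, q4, q5, q6]
  ring

theorem sqSumMoment1_pos {M : ℕ} {e1 e2 : Fin M → ℝ} (h1 : ∀ m, 0 ≤ e1 m) (h2 : ∀ m, 0 ≤ e2 m)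
    {i : Fin M} (hi : 0 < e2 i) : 0 < sqSumMoment1 e1 e2 := by
  have h : 0 < ∑ m, e2 m := Finset.sum_pos' (fun m _ => h2 m) ⟨i, Finset.mem_univ i, hi⟩
  have h' : 0 ≤ ∑ m, ∑ m₁ with m₁ ≠ m, e1 m * e1 m₁ :=
    Finset.sum_nonneg fun m _ => Finset.sum_nonneg fun m₁ _ => mul_nonneg (h1 _) (h1 _)
  exact add_pos_of_pos_of_nonneg h h'

theorem sum_sq_le_sqSumMoment2_sub {M : ℕ} {e1 e2 e3 e4 : Fin M → ℝ} (h1 : ∀ m, 0 ≤ e1 m)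
    (h12 : ∀ m, e1 m ^ 2 ≤ e2 m) (h123 : ∀ m, e1 m * e2 m ≤ e3 m) :
    ∑ m, (e4 m - e2 m ^ 2) ≤ sqSumMoment2 e1 e2 e3 e4 - sqSumMoment1 e1 e2 ^ 2 := by
  rw [sqSumMoment2_eq]
  have t1 : 0 ≤ ∑ m, ∑ m₁ with m₁ ≠ m, (e3 m - e1 m * e2 m) * e1 m₁ :=
    Finset.sum_nonneg fun m _ => Finset.sum_nonneg fun m₁ _ =>
      mul_nonneg (sub_nonneg.2 (h123 m)) (h1 _)
  have t2 : 0 ≤ ∑ m, ∑ m₁ with m₁ ≠ m, (e2 m * e2 m₁ - e1 m ^ 2 * e1 m₁ ^ 2) :=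
    Finset.sum_nonneg fun m _ => Finset.sum_nonneg fun m₁ _ =>
      sub_nonneg.2 (mul_le_mul (h12 m) (h12 m₁) (sq_nonneg _) ((sq_nonneg _).trans (h12 m)))
  have t3 : 0 ≤ ∑ m, ∑ m₁ with m₁ ≠ m, ∑ m₂ with m₂ ≠ m ∧ m₂ ≠ m₁,
          (e2 m - e1 m ^ 2) * e1 m₁ * e1 m₂ :=
    Finset.sum_nonneg fun m _ => Finset.sum_nonneg fun m₁ _ => Finset.sum_nonneg fun m₂ _ =>
      mul_nonneg (mul_nonneg (sub_nonneg.2 (h12 m)) (h1 _)) (h1 _)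
  linarith

theorem circMoment1_sq_le {M : ℕ} {a d : Fin M → ℝ} (ha : ∀ m, 0 ≤ a m)
    (had : ∀ m, a m ^ 2 ≤ d m) : circMoment1 a ^ 2 ≤ circMoment2 a d := by
  have t1 : 0 ≤ ∑ m, ∑ m₁ with m₁ ≠ m, a m * a m₁ :=
    Finset.sum_nonneg fun m _ => Finset.sum_nonneg fun m₁ _ => mul_nonneg (ha _) (ha _)
  have t2 : ∑ m, a m ^ 2 ≤ ∑ m, d m := Finset.sum_le_sum fun m _ => had m
  have t3 := sum_pairs_eq a a
  have q1 : ∀ m, a m * a m = a m ^ 2 := fun m => by ring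
  simp only [q1] at t3
  simp only [circMoment1, circMoment2]
  nlinarith

theorem lp_pos {M K N lp : ℕ} (S : CellFreeSystem M K N lp) (k : Fin K) : (0 : ℝ) < lp := by
  exact_mod_cast Fin.pos (S.pilot k)

theorem N_cast_pos {M K N lp : ℕ} (S : CellFreeSystem M K N lp)
    : (0 : ℝ) < N := by exact_mod_cast S.N_pos

theorem self_mem_copilot {M K N lp : ℕ} (S : CellFreeSystem M K N lp)
    (k : Fin K) : k ∈ S.copilot k := by simp [copilot]

theorem sum_copilot_pos {M K N lp : ℕ} (S : CellFreeSystem M K N lp)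
    (m : Fin M) (k : Fin K) : 0 < ∑ k₁ ∈ S.copilot k, S.β m k₁ :=
  Finset.sum_pos (fun i _ => S.β_pos m i) ⟨k, S.self_mem_copilot k⟩

theorem c_pos {M K N lp : ℕ} (S : CellFreeSystem M K N lp)
    (m : Fin M) (k : Fin K) : 0 < S.c m k := by
  have := S.lp_pos k
  have := S.ρp_pos
  have := S.β_pos m k
  have := S.sum_copilot_pos m k
  unfold c
  positivity

theorem c_le_β {M K N lp : ℕ} (S : CellFreeSystem M K N lp)
    (m : Fin M) (k : Fin K) : S.c m k ≤ S.β m k := by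
  have h1 := S.lp_pos k
  have h2 := S.ρp_pos
  have h3 := S.β_pos m k
  have h4 := S.sum_copilot_pos m k
  have h5 : S.β m k ≤ ∑ k₁ ∈ S.copilot k, S.β m k₁ :=
    Finset.single_le_sum (fun i _ => (S.β_pos m i).le) (S.self_mem_copilot k)
  unfold c
  rw [div_le_iff₀ (by positivity)]
  have : lp * S.ρp * S.β m k * S.β m k
      ≤ lp * S.ρp * S.β m k * ∑ k₁ ∈ S.copilot k, S.β m k₁ :=
    mul_le_mul_of_nonneg_left h5 (by positivity)
  nlinarith

theorem ξ1_nonneg {M K N lp : ℕ} (S : CellFreeSystem M K N lp)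
    (k k₁ : Fin K) (m : Fin M) : 0 ≤ S.ξ1 k k₁ m := Real.sqrt_nonneg _

theorem ξ1_sq {M K N lp : ℕ} (S : CellFreeSystem M K N lp)
    (k k₁ : Fin K) (m : Fin M) : S.ξ1 k k₁ m ^ 2 = N * S.η m k₁ * S.c m k := by
  have := S.η_nonneg m k₁
  have := S.c_pos m k
  exact Real.sq_sqrt (by positivity)

theorem ξ2_nonneg {M K N lp : ℕ} (S : CellFreeSystem M K N lp)
    (k k₁ : Fin K) (m : Fin M) : 0 ≤ S.ξ2 k k₁ m := by
  have := S.η_nonneg m k₁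
  have := S.c_pos m k
  unfold ξ2
  positivity

theorem ξ1_sq_le_ξ2 {M K N lp : ℕ} (S : CellFreeSystem M K N lp)
    (k k₁ : Fin K) (m : Fin M) : S.ξ1 k k₁ m ^ 2 ≤ S.ξ2 k k₁ m := by
  have := mul_nonneg (S.η_nonneg m k₁) (S.c_pos m k).le
  rw [ξ1_sq, ξ2]
  nlinarith

theorem ξ1_mul_ξ2_le_ξ3 {M K N lp : ℕ} (S : CellFreeSystem M K N lp) (k k₁ : Fin K) (m : Fin M) :
    S.ξ1 k k₁ m * S.ξ2 k k₁ m ≤ S.ξ3 k k₁ m := by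
  have h1 := S.η_nonneg m k₁
  have h2 := S.c_pos m k
  have h3 := S.N_cast_pos
  have hr : ∀ x : ℝ, 0 ≤ x → x ^ (3 / 2 : ℝ) = x * Real.sqrt x := by
    intro x hx
    rw [show (3 / 2 : ℝ) = 1 + 1 / 2 by norm_num,
      Real.rpow_add_of_nonneg hx (by norm_num) (by norm_num), Real.rpow_one, Real.sqrt_eq_rpow]
  rw [ξ1, ξ2, ξ3, hr _ h1, hr _ h2.le, Real.sqrt_mul (by positivity), Real.sqrt_mul (by positivity)]
  have hN : 0 < Real.sqrt N := Real.sqrt_pos.2 h3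
  have hs : Real.sqrt N = N / Real.sqrt N := by
    rw [eq_div_iff hN.ne', Real.mul_self_sqrt h3.le]
  -- Writing $\sqrt N=N/\sqrt N$ exposes a common nonnegative factor, and the claim becomes $N\le
  -- N+2$.
  nth_rewrite 1 [hs]
  have h4 : 0 ≤ (N + 1) / Real.sqrt N * (S.η m k₁ * Real.sqrt (S.η m k₁))
      * (S.c m k * Real.sqrt (S.c m k)) := by positivity
  calc _ = N * ((N + 1) / Real.sqrt N * (S.η m k₁ * Real.sqrt (S.η m k₁))
      * (S.c m k * Real.sqrt (S.c m k))) := by ring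
    _ ≤ (N + 2) * ((N + 1) / Real.sqrt N * (S.η m k₁ * Real.sqrt (S.η m k₁))
      * (S.c m k * Real.sqrt (S.c m k))) := by nlinarith
    _ = _ := by ring

/-- The explicit value shows strict positivity at every access point with $\eta>0$, which makes the
signal variance positive. -/
theorem ξ4_sub_ξ2_sq {M K N lp : ℕ} (S : CellFreeSystem M K N lp) (k k₁ : Fin K) (m : Fin M) :
    S.ξ4 k k₁ m - S.ξ2 k k₁ m ^ 2
      = (N + 1) * (4 * N + 6) / N * (S.η m k₁ * S.c m k) ^ 2 := by
  have h3 := S.N_cast_pos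
  rw [ξ4, ξ2]
  field_simp
  ring

theorem ξ2_sq_le_ξ4 {M K N lp : ℕ} (S : CellFreeSystem M K N lp)
    (k k₁ : Fin K) (m : Fin M) : 0 ≤ S.ξ4 k k₁ m - S.ξ2 k k₁ m ^ 2 := by
  rw [ξ4_sub_ξ2_sq]
  positivity

theorem meanU1_pos {M K N lp : ℕ} (S : CellFreeSystem M K N lp)
    {k : Fin K} (h : ∃ m, 0 < S.η m k) : 0 < S.meanU1 k := by
  obtain ⟨i, hi⟩ := h
  refine sqSumMoment1_pos (i := i) (S.ξ1_nonneg k k) (S.ξ2_nonneg k k) ?_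
  have := S.c_pos i k
  unfold ξ2
  positivity

theorem meanU1_sq_lt {M K N lp : ℕ} (S : CellFreeSystem M K N lp)
    {k : Fin K} (h : ∃ m, 0 < S.η m k) : S.meanU1 k ^ 2 < S.secondU1 k := by
  obtain ⟨i, hi⟩ := h
  have h1 := sum_sq_le_sqSumMoment2_sub (e4 := S.ξ4 k k) (S.ξ1_nonneg k k) (S.ξ1_sq_le_ξ2 k k)
    (S.ξ1_mul_ξ2_le_ξ3 k k)
  have h2 : 0 < ∑ m, (S.ξ4 k k m - S.ξ2 k k m ^ 2) := by
    refine Finset.sum_pos' (fun m _ => S.ξ2_sq_le_ξ4 k k m) ⟨i, Finset.mem_univ i, ?_⟩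
    have := S.c_pos i k
    have := S.N_cast_pos
    rw [ξ4_sub_ξ2_sq]
    positivity
  exact sub_pos.1 (h2.trans_le h1)

theorem circ_sq_le {M K N lp : ℕ} (S : CellFreeSystem M K N lp)
    (x y : ℝ) : (x * y) ^ 2 ≤ 2 * (N + 1) / N * x ^ 2 * y ^ 2 := by
  have hN := S.N_cast_pos
  have h1 : 1 ≤ 2 * ((N : ℝ) + 1) / N := by
    rw [le_div_iff₀ hN]
    linarith
  nlinarith [sq_nonneg (x * y)]

theorem meanU2_nonneg {M K N lp : ℕ} (S : CellFreeSystem M K N lp)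
    (k k₁ : Fin K) : 0 ≤ S.meanU2 k k₁ := by
  unfold meanU2
  split_ifs
  · exact add_nonneg (Finset.sum_nonneg fun m _ => S.ξ2_nonneg k k₁ m)
      (Finset.sum_nonneg fun m _ => Finset.sum_nonneg fun m₁ _ =>
        mul_nonneg (S.ξ1_nonneg _ _ _) (S.ξ1_nonneg _ _ _))
  · exact Finset.sum_nonneg fun m _ => mul_nonneg (S.η_nonneg m k₁) (S.c_pos m k).le

theorem meanU2_sq_le {M K N lp : ℕ} (S : CellFreeSystem M K N lp)
    (k k₁ : Fin K) : S.meanU2 k k₁ ^ 2 ≤ S.secondU2 k k₁ := by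
  unfold meanU2 secondU2
  split_ifs
  · have h1 := sum_sq_le_sqSumMoment2_sub (e4 := S.ξ4 k k₁) (S.ξ1_nonneg k k₁)
      (S.ξ1_sq_le_ξ2 k k₁) (S.ξ1_mul_ξ2_le_ξ3 k k₁)
    have h2 : 0 ≤ ∑ m, (S.ξ4 k k₁ m - S.ξ2 k k₁ m ^ 2) :=
      Finset.sum_nonneg fun m _ => S.ξ2_sq_le_ξ4 k k₁ m
    linarith
  · exact circMoment1_sq_le (fun m => mul_nonneg (S.η_nonneg m k₁) (S.c_pos m k).le)
      fun m => S.circ_sq_le _ _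

theorem meanU3_nonneg {M K N lp : ℕ} (S : CellFreeSystem M K N lp)
    (k k₁ : Fin K) : 0 ≤ S.meanU3 k k₁ := by
  unfold meanU3 circMoment1
  exact Finset.sum_nonneg fun m _ => mul_nonneg (S.η_nonneg m k₁) (sub_nonneg.2 (S.c_le_β m k))

theorem meanU3_sq_le {M K N lp : ℕ} (S : CellFreeSystem M K N lp)
    (k k₁ : Fin K) : S.meanU3 k k₁ ^ 2 ≤ S.secondU3 k k₁ :=
  circMoment1_sq_le (fun m => mul_nonneg (S.η_nonneg m k₁) (sub_nonneg.2 (S.c_le_β m k)))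
    fun _ => S.circ_sq_le _ _

theorem meanIN_pos {M K N lp : ℕ} (S : CellFreeSystem M K N lp) (k : Fin K) : 0 < S.meanIN k := by
  have h1 : 0 ≤ ∑ k₁ with k₁ ≠ k, S.meanU2 k k₁ := Finset.sum_nonneg fun _ _ => S.meanU2_nonneg _ _
  have h2 : 0 ≤ ∑ k₁, S.meanU3 k k₁ := Finset.sum_nonneg fun _ _ => S.meanU3_nonneg _ _
  have := S.ρd_pos
  unfold meanIN
  positivity

theorem meanIN_sq_lt {M K N lp : ℕ} (S : CellFreeSystem M K N lp)
    (k : Fin K) : S.meanIN k ^ 2 < S.secondIN k := by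
  have h1 : ∑ k₁ with k₁ ≠ k, S.meanU2 k k₁ ^ 2 ≤ ∑ k₁ with k₁ ≠ k, S.secondU2 k k₁ :=
    Finset.sum_le_sum fun _ _ => S.meanU2_sq_le _ _
  have h2 : ∑ k₁, S.meanU3 k k₁ ^ 2 ≤ ∑ k₁, S.secondU3 k k₁ :=
    Finset.sum_le_sum fun _ _ => S.meanU3_sq_le _ _
  have h3 : ∑ k₁, ∑ k₂ with k₂ ≠ k₁, S.meanU3 k k₁ * S.meanU3 k k₂
      = (∑ k₁, S.meanU3 k k₁) ^ 2 - ∑ k₁, S.meanU3 k k₁ ^ 2 := by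
    rw [sum_pairs_eq]
    simp only [sq]
  have h4 : ∑ k₁ with k₁ ≠ k, ∑ k₂ with k₂ ≠ k ∧ k₂ ≠ k₁, S.meanU2 k k₁ * S.meanU2 k k₂
      = (∑ k₁ with k₁ ≠ k, S.meanU2 k k₁) ^ 2 - ∑ k₁ with k₁ ≠ k, S.meanU2 k k₁ ^ 2 := by
    have : ∀ k₁ ∈ Finset.univ.filter (fun i => i ≠ k),
        ∑ k₂ with k₂ ≠ k ∧ k₂ ≠ k₁, S.meanU2 k k₁ * S.meanU2 k k₂
          = S.meanU2 k k₁ * (∑ k₂ with k₂ ≠ k, S.meanU2 k k₂) - S.meanU2 k k₁ ^ 2 := by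
      intro k₁ hk₁
      rw [← Finset.mul_sum, sum_ne_ne_eq _ (by simpa using hk₁), sum_ne_eq]
      ring
    rw [Finset.sum_congr rfl this, Finset.sum_sub_distrib, ← Finset.sum_mul, sq]
  unfold meanIN secondIN
  rw [h3, h4]
  -- After cancellation of the cross terms, second moment minus squared mean is this quantity plus
  -- the variance $2-1^2=1$ of the noise power, which gives strictness.
  have h5 : 0 ≤ S.ρd ^ 2 * ((∑ k₁ with k₁ ≠ k, S.secondU2 k k₁
      - ∑ k₁ with k₁ ≠ k, S.meanU2 k k₁ ^ 2)
      + (∑ k₁, S.secondU3 k k₁ - ∑ k₁, S.meanU3 k k₁ ^ 2)) :=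
    mul_nonneg (sq_nonneg _) (add_nonneg (sub_nonneg.2 h1) (sub_nonneg.2 h2))
  linarith

theorem gammaShape_pos {u v : ℝ} (hu : 0 < u) (hv : u ^ 2 < v) : 0 < gammaShape u v :=
  div_pos (by positivity) (sub_pos.2 hv)

theorem gammaScale_pos {u v : ℝ} (hu : 0 < u) (hv : u ^ 2 < v) : 0 < gammaScale u v :=
  div_pos (sub_pos.2 hv) hu

theorem gamma_parameters_pos {M K N lp : ℕ} (S : CellFreeSystem M K N lp)
    {k : Fin K} (h : ∃ m, 0 < S.η m k) :
    0 < S.j1 k ∧ 0 < S.χ1 k ∧ 0 < S.j2 k ∧ 0 < S.χ2 k :=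
  ⟨gammaShape_pos (S.meanU1_pos h) (S.meanU1_sq_lt h),
    gammaScale_pos (S.meanU1_pos h) (S.meanU1_sq_lt h),
    gammaShape_pos (S.meanIN_pos k) (S.meanIN_sq_lt k),
    gammaScale_pos (S.meanIN_pos k) (S.meanIN_sq_lt k)⟩

end CellFreeSystem

/-! ### The cut plane. -/

/-- The complex plane cut along `[1, ∞)`. -/
def cutPlane : Set ℂ := {z : ℂ | ¬ (z.im = 0 ∧ 1 ≤ z.re)}

theorem mem_cutPlane_iff_one_sub {z : ℂ} : z ∈ cutPlane ↔ 1 - z ∈ Complex.slitPlane := by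
  simp only [cutPlane, Set.mem_ofPred_eq, Complex.mem_slitPlane_iff, Complex.sub_re,
    Complex.one_re, Complex.sub_im, Complex.one_im, zero_sub, neg_ne_zero, sub_pos]
  rw [not_and_or, not_le, or_comm]

theorem isOpen_cutPlane : IsOpen cutPlane := by
  have : cutPlane = (fun z : ℂ => 1 - z) ⁻¹' Complex.slitPlane :=
    Set.ext fun z => mem_cutPlane_iff_one_sub
  rw [this]
  exact Complex.isOpen_slitPlane.preimage (by fun_prop)

/-- Segments from the origin stay in the cut plane, so averages over them are defined on all of it,
not only on the disc. -/
theorem mul_mem_cutPlane {t : ℝ} (h0 : 0 ≤ t) (h1 : t ≤ 1) {z : ℂ} (hz : z ∈ cutPlane) :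
    (t : ℂ) * z ∈ cutPlane := by
  simp only [cutPlane, Set.mem_ofPred_eq, Complex.mul_im, Complex.ofReal_re, Complex.ofReal_im,
    zero_mul, add_zero, Complex.mul_re, sub_zero] at hz ⊢
  rintro ⟨h2, h3⟩
  rcases mul_eq_zero.1 h2 with h4 | h4
  · rw [h4] at h3
    norm_num at h3
  · refine hz ⟨h4, ?_⟩
    by_contra! h5
    have h6 : t = 1 := le_antisymm h1 (by nlinarith)
    rw [h6] at h3
    linarith

theorem starConvex_cutPlane : StarConvex ℝ 0 cutPlane := by
  rw [starConvex_zero_iff]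
  intro z hz t h0 h1
  simpa using mul_mem_cutPlane h0 h1 hz

theorem isPreconnected_cutPlane : IsPreconnected cutPlane :=
  (starConvex_cutPlane.isPathConnected (by simp [cutPlane])).isConnected.isPreconnected

theorem mem_cutPlane_of_norm_lt {z : ℂ} (hz : ‖z‖ < 1) : z ∈ cutPlane := by
  rintro ⟨-, h⟩
  exact absurd (h.trans (Complex.re_le_norm z)) (not_le.2 hz)

theorem mem_cutPlane_of_im_neg {z : ℂ} (hz : z.im < 0) : z ∈ cutPlane := fun h => hz.ne h.1

/-! ### Beta averages over segments: holomorphy and power series. -/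

/-- The density `t ^ (p - 1) * (1 - t) ^ (q - 1)` of the Beta integral. -/
noncomputable def betaWeight (p q t : ℝ) : ℝ := t ^ (p - 1) * (1 - t) ^ (q - 1)

theorem betaWeight_nonneg (p q : ℝ) {t : ℝ} (ht : t ∈ Set.Ioo (0 : ℝ) 1) :
    0 ≤ betaWeight p q t :=
  mul_nonneg (Real.rpow_nonneg ht.1.le _) (Real.rpow_nonneg (sub_nonneg.2 ht.2.le) _)

theorem ofReal_betaWeight (p q : ℝ) {t : ℝ} (ht : t ∈ Set.Ioo (0 : ℝ) 1) :
    (betaWeight p q t : ℂ) = (t : ℂ) ^ ((p : ℂ) - 1) * (1 - (t : ℂ)) ^ ((q : ℂ) - 1) := by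
  rw [betaWeight, Complex.ofReal_mul, Complex.ofReal_cpow ht.1.le,
    Complex.ofReal_cpow (sub_nonneg.2 ht.2.le)]
  push_cast
  rfl

theorem continuousOn_betaWeight (p q : ℝ) : ContinuousOn (betaWeight p q) (Set.Ioo 0 1) := by
  intro t ht
  refine ContinuousAt.continuousWithinAt (ContinuousAt.mul ?_ ?_)
  · exact Real.continuousAt_rpow_const _ _ (Or.inl ht.1.ne')
  · exact ContinuousAt.rpow_const (by fun_prop) (Or.inl (sub_pos.2 ht.2).ne')

theorem integrableOn_betaWeight_complex {p q : ℝ} (hp : 0 < p) (hq : 0 < q) :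
    IntegrableOn (fun t => (betaWeight p q t : ℂ)) (Set.Ioo 0 1) := by
  have h := Complex.betaIntegral_convergent (u := p) (v := q) (by simpa) (by simpa)
  rw [intervalIntegrable_iff_integrableOn_Ioo_of_le zero_le_one] at h
  exact h.congr_fun (fun t ht => (ofReal_betaWeight p q ht).symm) measurableSet_Ioo

theorem integrableOn_betaWeight {p q : ℝ} (hp : 0 < p) (hq : 0 < q) :
    IntegrableOn (betaWeight p q) (Set.Ioo 0 1) := by
  exact (integrableOn_betaWeight_complex hp hq).re

theorem integral_betaWeight {p q : ℝ} (hp : 0 < p) (hq : 0 < q) :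
    ∫ t in Set.Ioo (0 : ℝ) 1, betaWeight p q t = ProbabilityTheory.beta p q := by
  have h : ((∫ t in Set.Ioo (0 : ℝ) 1, betaWeight p q t : ℝ) : ℂ) = Complex.betaIntegral p q := by
    rw [← integral_complex_ofReal, Complex.betaIntegral,
      intervalIntegral.integral_of_le zero_le_one, integral_Ioc_eq_integral_Ioo]
    exact setIntegral_congr_fun measurableSet_Ioo fun t ht => ofReal_betaWeight p q ht
  rw [ProbabilityTheory.beta_eq_betaIntegralReal p q hp hq, ← h, Complex.ofReal_re]

/-- The average of `h` over the segment from `0` to `z` with respect to the Beta density. -/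
noncomputable def betaTransform (p q : ℝ) (h : ℂ → ℂ) (z : ℂ) : ℂ :=
  ∫ t in Set.Ioo (0 : ℝ) 1, (betaWeight p q t : ℂ) * h (t * z)

theorem exists_bound_segments {g : ℂ → ℂ} (hg : ContinuousOn g cutPlane) {s : Set ℂ}
    (hs : IsCompact s) (hsc : s ⊆ cutPlane) :
    ∃ C, ∀ t ∈ Set.Icc (0 : ℝ) 1, ∀ z ∈ s, ‖g (t * z)‖ ≤ C := by
  have hK : IsCompact (Set.Icc (0 : ℝ) 1 ×ˢ s) := isCompact_Icc.prod hs
  have hc : ContinuousOn (fun p : ℝ × ℂ => g (p.1 * p.2)) (Set.Icc (0 : ℝ) 1 ×ˢ s) :=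
    hg.comp (by fun_prop) fun p hp => mul_mem_cutPlane hp.1.1 hp.1.2 (hsc hp.2)
  obtain ⟨C, hC⟩ := hK.exists_bound_of_continuousOn hc
  exact ⟨C, fun t ht z hz => hC (t, z) ⟨ht, hz⟩⟩

theorem aestronglyMeasurable_betaTransform (p q : ℝ) {g : ℂ → ℂ} (hg : ContinuousOn g cutPlane)
    {z : ℂ} (hz : z ∈ cutPlane) :
    AEStronglyMeasurable (fun t : ℝ => (betaWeight p q t : ℂ) * g (t * z))
      (volume.restrict (Set.Ioo 0 1)) := by
  refine ContinuousOn.aestronglyMeasurable (ContinuousOn.mul ?_ ?_) measurableSet_Ioo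
  · exact Complex.continuous_ofReal.comp_continuousOn (continuousOn_betaWeight p q)
  · exact hg.comp (by fun_prop) fun t ht => mul_mem_cutPlane ht.1.le ht.2.le hz

theorem integrableOn_betaTransform {p q : ℝ} (hp : 0 < p) (hq : 0 < q) {g : ℂ → ℂ}
    (hg : ContinuousOn g cutPlane) {z : ℂ} (hz : z ∈ cutPlane) :
    IntegrableOn (fun t : ℝ => (betaWeight p q t : ℂ) * g (t * z)) (Set.Ioo 0 1) := by
  obtain ⟨C, hC⟩ := exists_bound_segments hg isCompact_singleton (Set.singleton_subset_iff.2 hz)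
  refine Integrable.mono' ((integrableOn_betaWeight hp hq).mul_const C)
    (aestronglyMeasurable_betaTransform p q hg hz) ?_
  filter_upwards [ae_restrict_mem measurableSet_Ioo] with t ht
  rw [norm_mul, Complex.norm_real, Real.norm_of_nonneg (betaWeight_nonneg p q ht)]
  exact mul_le_mul_of_nonneg_left (hC t ⟨ht.1.le, ht.2.le⟩ z rfl) (betaWeight_nonneg p q ht)

theorem betaWeight_mul_self (p q : ℝ) {t : ℝ} (ht : t ∈ Set.Ioo (0 : ℝ) 1) :
    betaWeight p q t * t = betaWeight (p + 1) q t := by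
  rw [betaWeight, betaWeight, show p + 1 - 1 = (p - 1) + 1 by ring, Real.rpow_add_one ht.1.ne']
  ring

theorem betaWeight_mul_pow (p q : ℝ) {t : ℝ} (ht : t ∈ Set.Ioo (0 : ℝ) 1) (n : ℕ) :
    betaWeight p q t * t ^ n = betaWeight (p + n) q t := by
  rw [betaWeight, betaWeight, show p + n - 1 = (p - 1) + n by ring, Real.rpow_add_natCast ht.1.ne']
  ring

/-- Differentiation under the integral sign; the inner derivative $t$ is absorbed into the weight,
raising $p$ by one. -/
theorem hasDerivAt_betaTransform {p q : ℝ} (hp : 0 < p) (hq : 0 < q) {h : ℂ → ℂ}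
    (hh : DifferentiableOn ℂ h cutPlane) {z : ℂ} (hz : z ∈ cutPlane) :
    HasDerivAt (betaTransform p q h) (betaTransform (p + 1) q (deriv h) z) z := by
  obtain ⟨r, hr, hrs⟩ := Metric.nhds_basis_closedBall.mem_iff.1 (isOpen_cutPlane.mem_nhds hz)
  have hd : ContinuousOn (deriv h) cutPlane := (hh.deriv isOpen_cutPlane).continuousOn
  obtain ⟨C, hC⟩ := exists_bound_segments hd (isCompact_closedBall z r) hrs
  have key := hasDerivAt_integral_of_dominated_loc_of_deriv_le
    (μ := volume.restrict (Set.Ioo (0 : ℝ) 1))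
    (F := fun u (t : ℝ) => (betaWeight p q t : ℂ) * h (t * u))
    (F' := fun u (t : ℝ) => (betaWeight (p + 1) q t : ℂ) * deriv h (t * u))
    (bound := fun t => betaWeight (p + 1) q t * C) (x₀ := z)
    (Metric.closedBall_mem_nhds z hr) ?_ (integrableOn_betaTransform hp hq hh.continuousOn hz)
    (aestronglyMeasurable_betaTransform _ _ hd hz) ?_
    ((integrableOn_betaWeight (by positivity) hq).mul_const C) ?_
  · exact key.2
  · filter_upwards [isOpen_cutPlane.mem_nhds hz] with u hu
    exact aestronglyMeasurable_betaTransform _ _ hh.continuousOn hu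
  · filter_upwards [ae_restrict_mem measurableSet_Ioo] with t ht u hu
    rw [norm_mul, Complex.norm_real, Real.norm_of_nonneg (betaWeight_nonneg _ q ht)]
    exact mul_le_mul_of_nonneg_left (hC t ⟨ht.1.le, ht.2.le⟩ u hu) (betaWeight_nonneg _ q ht)
  · filter_upwards [ae_restrict_mem measurableSet_Ioo] with t ht u hu
    have h1 : HasDerivAt h (deriv h (t * u)) (t * u) :=
      (hh.differentiableAt (isOpen_cutPlane.mem_nhds
        (mul_mem_cutPlane ht.1.le ht.2.le (hrs hu)))).hasDerivAt
    have h2 : HasDerivAt (fun u : ℂ => (t : ℂ) * u) t u := by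
      simpa using (hasDerivAt_id u).const_mul (t : ℂ)
    have h3 := (h1.comp u h2).const_mul (betaWeight p q t : ℂ)
    refine h3.congr_deriv ?_
    rw [← betaWeight_mul_self p q ht]
    push_cast
    ring

theorem differentiableOn_betaTransform {p q : ℝ} (hp : 0 < p) (hq : 0 < q) {h : ℂ → ℂ}
    (hh : DifferentiableOn ℂ h cutPlane) : DifferentiableOn ℂ (betaTransform p q h) cutPlane :=
  fun _ hz => (hasDerivAt_betaTransform hp hq hh hz).differentiableAt.differentiableWithinAt

/-- Termwise integration: averaging multiplies the $n$-th coefficient by $B(p+n,q)$. This is the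
mechanism by which every hypergeometric function below is continued beyond the disc. -/
theorem hasSum_betaTransform {p q : ℝ} (hp : 0 < p) (hq : 0 < q) {h : ℂ → ℂ} {c : ℕ → ℂ}
    (hc : ∀ z : ℂ, ‖z‖ < 1 → HasSum (fun n => c n * z ^ n) (h z)) {z : ℂ} (hz : ‖z‖ < 1) :
    HasSum (fun n => c n * ProbabilityTheory.beta (p + n) q * z ^ n) (betaTransform p q h z) := by
  have hsum : Summable fun n => ‖c n * z ^ n‖ := (hc z hz).summable.norm
  have hterm : ∀ n : ℕ, ∫ t in Set.Ioo (0 : ℝ) 1, (betaWeight p q t : ℂ) * (c n * (t * z) ^ n)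
      = c n * ProbabilityTheory.beta (p + n) q * z ^ n := by
    intro n
    rw [← integral_betaWeight (by positivity) hq, ← integral_complex_ofReal,
      mul_assoc, mul_comm (∫ _ in _, _) (z ^ n), ← mul_assoc, ← integral_const_mul]
    refine setIntegral_congr_fun measurableSet_Ioo fun t ht => ?_
    rw [← betaWeight_mul_pow p q ht n, mul_pow]
    push_cast
    ring
  simp only [← hterm]
  refine hasSum_integral_of_dominated_convergence
    (fun n t => betaWeight p q t * ‖c n * z ^ n‖) (fun n => ?_) (fun n => ?_) ?_ ?_ ?_
  · exact aestronglyMeasurable_betaTransform p q (g := fun u => c n * u ^ n) (by fun_prop)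
      (mem_cutPlane_of_norm_lt hz)
  · filter_upwards [ae_restrict_mem measurableSet_Ioo] with t ht
    rw [norm_mul, Complex.norm_real, Real.norm_of_nonneg (betaWeight_nonneg _ q ht)]
    refine mul_le_mul_of_nonneg_left ?_ (betaWeight_nonneg _ q ht)
    rw [mul_pow, ← mul_assoc, mul_comm (c n), mul_assoc, norm_mul, norm_pow, Complex.norm_real,
      Real.norm_of_nonneg ht.1.le]
    exact mul_le_of_le_one_left (norm_nonneg _) (pow_le_one₀ ht.1.le ht.2.le)
  · exact ae_of_all _ fun t => hsum.mul_left _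
  · simp only [tsum_mul_left]
    exact (integrableOn_betaWeight hp hq).mul_const _
  · filter_upwards [ae_restrict_mem measurableSet_Ioo] with t ht
    refine (hc _ ?_).mul_left _
    rw [norm_mul, Complex.norm_real, Real.norm_of_nonneg ht.1.le]
    exact (mul_le_of_le_one_left (norm_nonneg _) ht.2.le).trans_lt hz

/-! ### From coefficient recursions to differential equations on the cut plane. -/

theorem hasSum_mul_deriv {f : ℂ → ℂ} {c : ℕ → ℂ}
    (hc : ∀ z : ℂ, ‖z‖ < 1 → HasSum (fun n => c n * z ^ n) (f z)) {z : ℂ} (hz : ‖z‖ < 1) :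
    HasSum (fun n => n * c n * z ^ n) (z * deriv f z) := by
  obtain ⟨r, hr, hr1⟩ := exists_between hz
  have hr0 : 0 ≤ r := (norm_nonneg z).trans hr.le
  have hu : Summable fun n => ‖c n‖ * r ^ n := by
    have := (hc r (by rwa [Complex.norm_real, Real.norm_of_nonneg hr0])).summable.norm
    simpa [abs_of_nonneg hr0] using this
  have h := Complex.hasSum_deriv_of_summable_norm (F := fun n w => c n * w ^ n)
    (U := Metric.ball 0 r) (z := z) hu (fun n => by fun_prop) Metric.isOpen_ball
    (fun n w hw => by
      rw [norm_mul, norm_pow]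
      have : ‖w‖ < r := by simpa using hw
      gcongr) (by simpa using hr)
  have he : deriv (fun w => ∑' n, c n * w ^ n) z = deriv f z := by
    apply EventuallyEq.deriv_eq
    filter_upwards [Metric.isOpen_ball.mem_nhds (show z ∈ Metric.ball (0 : ℂ) 1 by simpa using hz)]
      with w hw
    exact (hc w (by simpa using hw)).tsum_eq
  rw [he] at h
  have hn : ∀ n : ℕ, (n : ℂ) * c n * z ^ n = z * deriv (fun w => c n * w ^ n) z := by
    intro n
    rw [deriv_const_mul_field, deriv_pow_field]
    rcases n with _ | n
    · simp
    · simp only [Nat.add_sub_cancel, pow_succ]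
      ring
  simp only [hn]
  exact h.mul_left z

theorem eqOn_cutPlane_of_disc {f g : ℂ → ℂ} (hf : DifferentiableOn ℂ f cutPlane)
    (hg : DifferentiableOn ℂ g cutPlane) (h : ∀ z : ℂ, ‖z‖ < 1 → f z = g z) :
    Set.EqOn f g cutPlane := by
  refine (hf.analyticOnNhd isOpen_cutPlane).eqOn_of_preconnected_of_eventuallyEq
    (hg.analyticOnNhd isOpen_cutPlane) isPreconnected_cutPlane (z₀ := 0) (by simp [cutPlane]) ?_
  filter_upwards [Metric.isOpen_ball.mem_nhds (Metric.mem_ball_self (x := (0 : ℂ)) one_pos)]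
    with z hz
  exact h z (by simpa using hz)

/-- A power series with `cₙ₊₁ (γ + n) = cₙ (α + n)` solves a first order linear equation. -/
theorem deriv_eq_of_coeff_ratio {f : ℂ → ℂ} {c : ℕ → ℂ} {α γ : ℂ}
    (hf : DifferentiableOn ℂ f cutPlane)
    (hc : ∀ z : ℂ, ‖z‖ < 1 → HasSum (fun n => c n * z ^ n) (f z))
    (hr : ∀ n : ℕ, c (n + 1) * (γ + n) = c n * (α + n)) {z : ℂ} (hz : z ∈ cutPlane) :
    z * (1 - z) * deriv f z = (γ - 1) * (c 0 - f z) + α * z * f z := by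
  have hd := hf.deriv isOpen_cutPlane
  refine eqOn_cutPlane_of_disc (f := fun z => z * (1 - z) * deriv f z)
    (g := fun z => (γ - 1) * (c 0 - f z) + α * z * f z) (by fun_prop) (by fun_prop) ?_ hz
  intro z hz
  have h1 := hc z hz
  have h2 := hasSum_mul_deriv hc hz
  have h3 := (h2.add (h1.mul_left (γ - 1)))
  -- Splitting off the term of index 0 leaves the constant $(\gamma-1)c_0$; the shifted series then
  -- matches `h4` through the recursion.
  rw [← hasSum_nat_add_iff' 1] at h3
  have h4 := (h2.add (h1.mul_left α)).mul_left z
  have h5 : ∀ n : ℕ, ((n + 1 : ℕ) : ℂ) * c (n + 1) * z ^ (n + 1)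
        + (γ - 1) * (c (n + 1) * z ^ (n + 1))
      = z * (n * c n * z ^ n + α * (c n * z ^ n)) := by
    intro n
    push_cast
    linear_combination z ^ (n + 1) * hr n
  simp only [h5] at h3
  have h6 := h3.unique h4
  simp only [Finset.range_one, Finset.sum_singleton, Nat.cast_zero, pow_zero] at h6
  linear_combination h6

/-- A power series with `cₙ (β + n) = dₙ` solves a first order linear equation. -/
theorem mul_deriv_add_of_coeff {f g : ℂ → ℂ} {c d : ℕ → ℂ} {β : ℂ}
    (hf : DifferentiableOn ℂ f cutPlane) (hg : DifferentiableOn ℂ g cutPlane)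
    (hc : ∀ z : ℂ, ‖z‖ < 1 → HasSum (fun n => c n * z ^ n) (f z))
    (hd : ∀ z : ℂ, ‖z‖ < 1 → HasSum (fun n => d n * z ^ n) (g z))
    (hr : ∀ n : ℕ, c n * (β + n) = d n) {z : ℂ} (hz : z ∈ cutPlane) :
    z * deriv f z + β * f z = g z := by
  have hd' := hf.deriv isOpen_cutPlane
  refine eqOn_cutPlane_of_disc (f := fun z => z * deriv f z + β * f z) (g := g) (by fun_prop)
    hg ?_ hz
  intro z hz
  have h3 := (hasSum_mul_deriv hc hz).add ((hc z hz).mul_left β)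
  refine h3.unique ?_
  convert hd z hz using 2 with n
  rw [← hr]
  ring

/-! ### Limits at the cut, and existence and uniqueness of principal branches. -/

/-- A function on the lower half-plane whose product with a factor `m` has a bounded derivative
near `x`, `m` being continuous and nonzero at `x`, has a limit at `x`. -/
theorem exists_tendsto_of_bounded_deriv {f m d : ℂ → ℂ} {x : ℂ}
    (hm : ContinuousAt m x) (hmx : m x ≠ 0)
    (hd : ∀ᶠ z in 𝓝[{z : ℂ | z.im < 0}] x, HasDerivAt (fun w => m w * f w) (d z) z)
    {C : ℝ} (hC : ∀ᶠ z in 𝓝[{z : ℂ | z.im < 0}] x, ‖d z‖ ≤ C) :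
    ∃ l, Tendsto f (𝓝[{z : ℂ | z.im < 0}] x) (𝓝 l) := by
  obtain ⟨r, hr, hrs⟩ := Metric.mem_nhdsWithin_iff.1 (hd.and hC)
  set s := Metric.ball x r ∩ {z : ℂ | z.im < 0} with hs
  have hconv : Convex ℝ s := (convex_ball x r).inter (convex_halfSpace_im_lt 0)
  have hlip : LipschitzOnWith C.toNNReal (fun w => m w * f w) s := by
    refine hconv.lipschitzOnWith_of_nnnorm_hasDerivWithin_le (f' := d)
      (fun z hz => (hrs hz).1.hasDerivWithinAt) fun z hz => ?_
    exact NNReal.le_toNNReal_of_coe_le (hrs hz).2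
  -- On the convex half-disc `s` a bounded derivative gives a Lipschitz function, whose extension to
  -- the plane is continuous at `x` and supplies the limit.
  obtain ⟨g, hg, hgs⟩ := hlip.extend_finite_dimension
  refine ⟨(m x)⁻¹ * g x, Tendsto.congr' ?_ ((hm.inv₀ hmx).mul
    hg.continuous.continuousAt |>.tendsto.mono_left nhdsWithin_le_nhds)⟩
  have hmem : s ∈ 𝓝[{z : ℂ | z.im < 0}] x := by
    rw [hs, Set.inter_comm]
    exact inter_mem_nhdsWithin _ (Metric.ball_mem_nhds x hr)
  filter_upwards [hmem, (hm.eventually_ne hmx).filter_mono nhdsWithin_le_nhds] with z hz hz'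
  simp only [Pi.mul_apply, Pi.inv_apply]
  rw [← hgs hz, inv_mul_cancel_left₀ hz']

/-- The values of `F` on the cut are arbitrary, so they are replaced by the lower limits; at 1 any
value will do. -/
theorem IsPrincipalBranch.of_tendsto {f F : ℂ → ℂ} (hF : DifferentiableOn ℂ F cutPlane)
    (hf : ∀ z : ℂ, ‖z‖ < 1 → F z = f z)
    (hl : ∀ x : ℝ, 1 < x → ∃ l, Tendsto F (𝓝[{z : ℂ | z.im < 0}] (x : ℂ)) (𝓝 l)) :
    ∃ G, IsPrincipalBranch f G := by
  classical
  choose! l hl using hl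
  have hG : ∀ z ∈ cutPlane, (if z ∈ cutPlane then F z else l z.re) = F z := fun z hz => if_pos hz
  refine ⟨fun z => if z ∈ cutPlane then F z else l z.re, hF.congr hG, fun z hz => ?_,
    fun x hx => ?_⟩
  · rw [hG z (mem_cutPlane_of_norm_lt hz), hf z hz]
  · have hx' : (x : ℂ) ∉ cutPlane := by simpa [cutPlane] using hx.le
    simp only [hx', if_false, Complex.ofReal_re]
    refine (hl x hx).congr' ?_
    filter_upwards [self_mem_nhdsWithin] with z hz
    exact (hG z (mem_cutPlane_of_im_neg hz)).symm

/-- By the identity theorem, the branch obtained by choice inherits the differential equations of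
any explicit continuation. -/
theorem IsPrincipalBranch.eqOn {f F G : ℂ → ℂ} (hG : IsPrincipalBranch f G)
    (hF : DifferentiableOn ℂ F cutPlane) (hf : ∀ z : ℂ, ‖z‖ < 1 → F z = f z) :
    Set.EqOn G F cutPlane :=
  eqOn_cutPlane_of_disc hG.holo hF fun z hz => (hG.eq_disc z hz).trans (hf z hz).symm

theorem isPrincipalBranch_principalBranch {f : ℂ → ℂ} (h : ∃ F, IsPrincipalBranch f F) :
    IsPrincipalBranch f (principalBranch f) := by
  rw [principalBranch, dif_pos h]
  exact h.choose_spec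

theorem hasSum_one_sub_cpow_neg (s : ℂ) {z : ℂ} (hz : ‖z‖ < 1) :
    HasSum (fun n : ℕ => (ascPochhammer ℂ n).eval s / (n.factorial : ℂ) * z ^ n)
      ((1 - z) ^ (-s)) := by
  have h := (Complex.one_div_one_sub_cpow_hasFPowerSeriesOnBall_zero s).hasSum (y := z)
    (by simpa [enorm_eq_nnnorm, ← NNReal.coe_lt_coe] using hz)
  simp only [FormalMultilinearSeries.ofScalars_apply_eq, zero_add, one_div, smul_eq_mul,
    ← Complex.cpow_neg] at h
  have hn : ∀ n : ℕ, (ascPochhammer ℂ n).eval s / (n.factorial : ℂ)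
      = Ring.choose (s + n - 1) n := by
    intro n
    rw [← Ring.multichoose_eq, div_eq_iff (by exact_mod_cast n.factorial_ne_zero)]
    have := Ring.factorial_nsmul_multichoose_eq_ascPochhammer s n
    rw [Polynomial.ascPochhammer_smeval_eq_eval] at this
    rw [← this, nsmul_eq_mul, mul_comm]
  simpa only [hn] using h

theorem differentiableOn_one_sub_cpow (s : ℂ) :
    DifferentiableOn ℂ (fun z : ℂ => (1 - z) ^ s) cutPlane := fun z hz =>
  (DifferentiableAt.cpow (by fun_prop) (by fun_prop)
    (mem_cutPlane_iff_one_sub.1 hz)).differentiableWithinAt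

/-! ### Beta function identities and the function ${}_2F_1(1,\alpha;\gamma;z)$. -/

namespace ProbabilityTheory

theorem beta_comm (p q : ℝ) : beta p q = beta q p := by
  rw [beta, beta, mul_comm, add_comm]

theorem beta_one_right {p : ℝ} (hp : 0 < p) : beta p 1 = 1 / p := by
  have := (Real.Gamma_pos_of_pos hp).ne'
  rw [beta, Real.Gamma_add_one hp.ne', Real.Gamma_one]
  field_simp

theorem beta_add_one_mul {p q : ℝ} (hp : 0 < p) (hq : 0 < q) :
    beta (p + 1) q * (p + q) = beta p q * p := by
  have := (Real.Gamma_pos_of_pos (add_pos hp hq)).ne'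
  rw [beta, beta, Real.Gamma_add_one hp.ne', add_right_comm, Real.Gamma_add_one (by positivity)]
  field_simp

/-- The factor turning the binomial series of $(1-z)^{-\alpha}$ into the series of
${}_2F_1(1,\alpha;\gamma;z)$. -/
theorem beta_one_add_nat {γ : ℝ} (hγ : 1 < γ) (n : ℕ) :
    (γ - 1) * beta (1 + n) (γ - 1) = n.factorial / (ascPochhammer ℝ n).eval γ := by
  have h1 : 0 < γ - 1 := sub_pos.2 hγ
  induction n with
  | zero =>
    rw [beta_comm, Nat.cast_zero, add_zero, beta_one_right h1]
    simp [h1.ne']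
  | succ n ih =>
    have h2 := ascPochhammer_pos n γ (by linarith)
    have h3 := beta_add_one_mul (p := 1 + n) (by positivity) h1
    have h4 : 0 < γ + n := by positivity
    rw [eq_div_iff h2.ne'] at ih
    rw [ascPochhammer_succ_eval, eq_div_iff (by positivity), Nat.factorial_succ]
    push_cast
    rw [← add_assoc, ← ih]
    linear_combination (γ - 1) * (ascPochhammer ℝ n).eval γ * h3

end ProbabilityTheory

theorem ofReal_ascPochhammer (n : ℕ) (x : ℝ) :
    (((ascPochhammer ℝ n).eval x : ℝ) : ℂ) = (ascPochhammer ℂ n).eval (x : ℂ) := by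
  rw [← ascPochhammer_map Complex.ofRealHom n, Polynomial.eval_map, ← Complex.ofRealHom_eq_coe,
    ← Complex.ofRealHom_eq_coe, Polynomial.eval₂_hom]

/-- Euler's integral for `₂F₁(1, α; γ; z)`, in the limit at the branch point. -/
theorem tendsto_one_sub_rpow_mul_of_deriv {f : ℂ → ℂ} {α γ δ : ℝ} (hγ : 1 < γ) (hδ : 0 < δ)
    (hα : α = γ - 1 + δ) (hf : DifferentiableOn ℂ f cutPlane)
    (hd : ∀ z ∈ cutPlane, z * (1 - z) * deriv f z = (γ - 1) * (1 - f z) + α * z * f z) :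
    Tendsto (fun x : ℝ => (((1 - x) ^ δ : ℝ) : ℂ) * f x) (𝓝[<] 1)
      (𝓝 ((Real.Gamma γ * Real.Gamma δ / Real.Gamma α : ℝ) : ℂ)) := by
  have hγ1 : 0 < γ - 1 := sub_pos.2 hγ
  -- The integrating factor $x^{\gamma-1}(1-x)^\delta$ turns the equation into
  -- $\varphi'=(\gamma-1)x^{\gamma-2}(1-x)^{\delta-1}$. Since $\varphi(0)=0$ for $\gamma>1$, the
  -- limit at 1 is a complete Beta integral.
  set φ : ℝ → ℂ := fun x => ((x ^ (γ - 1) * (1 - x) ^ δ : ℝ) : ℂ) * f x with hφ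
  have hmem : ∀ x : ℝ, x < 1 → (x : ℂ) ∈ cutPlane := by
    intro x hx
    simpa [cutPlane] using hx
  have hderiv : ∀ x ∈ Set.Ioo (0 : ℝ) 1,
      HasDerivAt φ ((γ - 1 : ℝ) * (betaWeight (γ - 1) δ x : ℂ)) x := by
    intro x hx
    have hx1 : 0 < 1 - x := sub_pos.2 hx.2
    have h1 : HasDerivAt (fun x : ℝ => x ^ (γ - 1)) ((γ - 1) * x ^ (γ - 1 - 1)) x :=
      Real.hasDerivAt_rpow_const (Or.inl hx.1.ne')
    have h2 : HasDerivAt (fun x : ℝ => (1 - x) ^ δ) (-1 * δ * (1 - x) ^ (δ - 1)) x :=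
      ((hasDerivAt_id x).const_sub 1).rpow_const (Or.inl hx1.ne')
    have h3 : HasDerivAt (fun x : ℝ => f x) (deriv f x) x :=
      (hf.differentiableAt (isOpen_cutPlane.mem_nhds (hmem x hx.2))).hasDerivAt.comp_ofReal
    have h4 := (h1.mul h2).ofReal_comp.mul h3
    refine h4.congr_deriv ?_
    have hd' := hd x (hmem x hx.2)
    have e1 : x ^ (γ - 1) = x ^ (γ - 1 - 1) * x := by
      rw [← Real.rpow_add_one hx.1.ne']
      ring_nf
    have e2 : (1 - x) ^ δ = (1 - x) ^ (δ - 1) * (1 - x) := by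
      rw [← Real.rpow_add_one hx1.ne']
      ring_nf
    rw [betaWeight, Pi.mul_apply, e1, e2]
    rw [hα] at hd'
    push_cast at hd' ⊢
    linear_combination (x ^ (γ - 1 - 1) : ℝ) * ((1 - x) ^ (δ - 1) : ℝ) * hd'
  have hint : IntervalIntegrable (fun x => ((γ - 1 : ℝ) : ℂ) * (betaWeight (γ - 1) δ x : ℂ))
      volume 0 1 := by
    rw [intervalIntegrable_iff_integrableOn_Ioo_of_le zero_le_one]
    exact (integrableOn_betaWeight_complex hγ1 hδ).const_mul _
  have hval : ∀ x ∈ Set.Ioo (0 : ℝ) 1,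
      ∫ t in (0 : ℝ)..x, ((γ - 1 : ℝ) : ℂ) * (betaWeight (γ - 1) δ t : ℂ) = φ x := by
    intro x hx
    have h0 : φ 0 = 0 := by simp [hφ, Real.zero_rpow hγ1.ne']
    rw [← sub_zero (φ x), ← h0]
    refine intervalIntegral.integral_eq_sub_of_hasDerivAt_of_le hx.1.le ?_
      (fun t ht => hderiv t ⟨ht.1, ht.2.trans hx.2⟩) ?_
    · refine ContinuousOn.mul (Complex.continuous_ofReal.comp_continuousOn
        (ContinuousOn.mul ?_ ?_)) ?_
      · exact (Real.continuous_rpow_const hγ1.le).continuousOn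
      · exact ((Real.continuous_rpow_const hδ.le).comp (by fun_prop)).continuousOn
      · exact hf.continuousOn.comp (by fun_prop) fun t ht => hmem t (ht.2.trans_lt hx.2)
    · exact hint.mono_set (by
        rw [Set.uIcc_of_le hx.1.le, Set.uIcc_of_le zero_le_one]
        exact Set.Icc_subset_Icc_right hx.2.le)
  have hI : ∫ t in (0 : ℝ)..1, ((γ - 1 : ℝ) : ℂ) * (betaWeight (γ - 1) δ t : ℂ)
      = ((Real.Gamma γ * Real.Gamma δ / Real.Gamma α : ℝ) : ℂ) := by
    rw [intervalIntegral.integral_of_le zero_le_one, integral_Ioc_eq_integral_Ioo,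
      integral_const_mul, integral_complex_ofReal, integral_betaWeight hγ1 hδ, ← Complex.ofReal_mul,
      ProbabilityTheory.beta, ← hα, show Real.Gamma γ = (γ - 1) * Real.Gamma (γ - 1) by
        rw [← Real.Gamma_add_one hγ1.ne', sub_add_cancel]]
    congr 1
    ring
  have hlim : Tendsto φ (𝓝[<] 1)
      (𝓝 ((Real.Gamma γ * Real.Gamma δ / Real.Gamma α : ℝ) : ℂ)) := by
    rw [← hI]
    have hc := intervalIntegral.continuousOn_primitive_interval (a := (0 : ℝ)) (b := 1)
      (μ := volume) (f := fun x => ((γ - 1 : ℝ) : ℂ) * (betaWeight (γ - 1) δ x : ℂ)) (by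
        rw [Set.uIcc_of_le zero_le_one, integrableOn_Icc_iff_integrableOn_Ioo]
        exact (integrableOn_betaWeight_complex hγ1 hδ).const_mul _)
    have hc1 := (hc 1 (by simp)).tendsto
    rw [Set.uIcc_of_le zero_le_one] at hc1
    have hle : 𝓝[<] (1 : ℝ) ≤ 𝓝[Set.Icc 0 1] 1 := by
      rw [← nhdsWithin_Ioo_eq_nhdsLT zero_lt_one]
      exact nhdsWithin_mono _ Set.Ioo_subset_Icc_self
    refine (hc1.mono_left hle).congr' ?_
    filter_upwards [Ioo_mem_nhdsLT zero_lt_one] with x hx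
    exact hval x hx
  have hone : Tendsto (fun x : ℝ => ((x ^ (γ - 1) : ℝ) : ℂ)) (𝓝[<] 1) (𝓝 1) := by
    have h : ContinuousAt (fun x : ℝ => ((x ^ (γ - 1) : ℝ) : ℂ)) 1 :=
      Complex.continuous_ofReal.continuousAt.comp
        (Real.continuous_rpow_const hγ1.le).continuousAt
    simpa using h.tendsto.mono_left nhdsWithin_le_nhds
  have h := hlim.div hone one_ne_zero
  rw [div_one] at h
  refine h.congr' ?_
  filter_upwards [Ioo_mem_nhdsLT zero_lt_one] with x hx
  have hx0 : ((x ^ (γ - 1) : ℝ) : ℂ) ≠ 0 := by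
    exact_mod_cast (Real.rpow_pos_of_pos hx.1 _).ne'
  simp only [hφ, Pi.div_apply]
  rw [Complex.ofReal_mul, mul_assoc, mul_div_cancel_left₀ _ hx0]

/-- The coefficients of `₂F₁(1, α; γ; z)`. -/
noncomputable def pochRatio (α γ : ℂ) (n : ℕ) : ℂ :=
  (ascPochhammer ℂ n).eval α / (ascPochhammer ℂ n).eval γ

theorem pochRatio_zero (α γ : ℂ) : pochRatio α γ 0 = 1 := by simp [pochRatio]

theorem ascPochhammer_eval_ne_zero {γ : ℂ} (hγ : ∀ n : ℕ, γ + n ≠ 0) (n : ℕ) :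
    (ascPochhammer ℂ n).eval γ ≠ 0 := by
  induction n with
  | zero => simp
  | succ n ih =>
    rw [ascPochhammer_succ_eval]
    exact mul_ne_zero ih (hγ n)

theorem pochRatio_succ_mul (α : ℂ) {γ : ℂ} (hγ : ∀ n : ℕ, γ + n ≠ 0) (n : ℕ) :
    pochRatio α γ (n + 1) * (γ + n) = pochRatio α γ n * (α + n) := by
  have h1 := ascPochhammer_eval_ne_zero hγ n
  have h2 := hγ n
  rw [pochRatio, pochRatio, ascPochhammer_succ_eval, ascPochhammer_succ_eval]
  field_simp

theorem pochRatio_succ (α γ : ℂ) (n : ℕ) :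
    pochRatio α γ (n + 1) = α / γ * pochRatio (α + 1) (γ + 1) n := by
  rw [pochRatio, pochRatio, ascPochhammer_succ_left]
  simp only [Polynomial.eval_mul, Polynomial.eval_X, Polynomial.eval_comp, Polynomial.eval_add,
    Polynomial.eval_one]
  rw [mul_div_mul_comm]

theorem add_natCast_ne_zero {γ : ℝ} (hγ : ∀ n : ℕ, γ + n ≠ 0) (n : ℕ) : (γ : ℂ) + n ≠ 0 := by
  exact_mod_cast hγ n

/-- Euler's integral $(\gamma-1)\int_0^1(1-t)^{\gamma-2}(1-tz)^{-\alpha}dt$, which converges at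
$t=1$ only for $\gamma>1$. -/
theorem exists_euler_integral (α : ℝ) {γ : ℝ} (hγ1 : 1 < γ) : ∃ H : ℂ → ℂ,
    DifferentiableOn ℂ H cutPlane ∧
    ∀ z : ℂ, ‖z‖ < 1 → HasSum (fun n => pochRatio α γ n * z ^ n) (H z) := by
  have hγ0 : 0 < γ - 1 := sub_pos.2 hγ1
  have hγ' : ∀ n : ℕ, γ + n ≠ 0 := fun n => by positivity
  have hd : DifferentiableOn ℂ (fun z => ((γ - 1 : ℝ) : ℂ)
      * betaTransform 1 (γ - 1) (fun w => (1 - w) ^ (-(α : ℂ))) z) cutPlane :=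
    (differentiableOn_betaTransform one_pos hγ0 (differentiableOn_one_sub_cpow _)).const_mul _
  have hs : ∀ z : ℂ, ‖z‖ < 1 → HasSum (fun n => pochRatio α γ n * z ^ n) (((γ - 1 : ℝ) : ℂ)
      * betaTransform 1 (γ - 1) (fun w => (1 - w) ^ (-(α : ℂ))) z) := by
    intro z hz
    have h := (hasSum_betaTransform one_pos hγ0
      (fun w hw => hasSum_one_sub_cpow_neg (α : ℂ) hw) hz).mul_left ((γ - 1 : ℝ) : ℂ)
    have hn : ∀ n : ℕ, pochRatio α γ n * z ^ n = ((γ - 1 : ℝ) : ℂ)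
        * ((ascPochhammer ℂ n).eval (α : ℂ) / (n.factorial : ℂ)
          * (ProbabilityTheory.beta (1 + n) (γ - 1) : ℝ) * z ^ n) := by
      intro n
      have hb := congrArg (fun x : ℝ => (x : ℂ)) (ProbabilityTheory.beta_one_add_nat hγ1 n)
      simp only [Complex.ofReal_mul, Complex.ofReal_div, ofReal_ascPochhammer,
        Complex.ofReal_natCast] at hb
      have hf : (n.factorial : ℂ) ≠ 0 := by exact_mod_cast n.factorial_ne_zero
      have hp := ascPochhammer_eval_ne_zero (add_natCast_ne_zero hγ') n
      have hb' : pochRatio α γ n = ((γ - 1 : ℝ) : ℂ) * ((ascPochhammer ℂ n).eval (α : ℂ)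
          / (n.factorial : ℂ) * (ProbabilityTheory.beta (1 + n) (γ - 1) : ℝ)) := by
        rw [mul_left_comm, hb, pochRatio]
        field_simp
      rw [hb']
      ring
    simp only [hn]
    exact h
  exact ⟨_, hd, hs⟩

/-- The function `₂F₁(1, α; γ; z)` on the cut plane, with its behaviour at the branch point. -/
theorem exists_hypergeometric_one {δ : ℝ} (hδ : 0 < δ) (m : ℕ) : ∀ {α γ : ℝ}, 0 < α →
    α = γ - 1 + δ → 1 < γ + m → (∀ n : ℕ, γ + n ≠ 0) → ∃ H : ℂ → ℂ,
      DifferentiableOn ℂ H cutPlane ∧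
      (∀ z : ℂ, ‖z‖ < 1 → HasSum (fun n => pochRatio α γ n * z ^ n) (H z)) ∧
      Tendsto (fun x : ℝ => (((1 - x) ^ δ : ℝ) : ℂ) * H x) (𝓝[<] 1)
        (𝓝 ((Real.Gamma γ * Real.Gamma δ / Real.Gamma α : ℝ) : ℂ)) := by
  induction m with
  | zero =>
    intro α γ hα hαγ hγm hγ
    have hγ1 : 1 < γ := by simpa using hγm
    have hγ0 : 0 < γ - 1 := sub_pos.2 hγ1
    obtain ⟨H, hd, hs⟩ := exists_euler_integral α hγ1
    refine ⟨H, hd, hs, tendsto_one_sub_rpow_mul_of_deriv hγ1 hδ hαγ hd fun z hz => ?_⟩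
    have h := deriv_eq_of_coeff_ratio hd hs
      (pochRatio_succ_mul (α : ℂ) (add_natCast_ne_zero hγ)) hz
    rwa [pochRatio_zero] at h
  | succ m ih =>
    intro α γ hα hαγ hγm hγ
    have hγ0 : γ ≠ 0 := by simpa using hγ 0
    -- For $\gamma\le1$ Euler's integral is not available. Since
    -- ${}_2F_1(1,\alpha;\gamma;z)=1+\frac{\alpha}{\gamma}z\,{}_2F_1(1,\alpha+1;\gamma+1;z)$, the
    -- parameter $\gamma$ can be raised by one; $\delta=\alpha-\gamma+1$ does not change.
    obtain ⟨H, hd, hs, ht⟩ := ih (α := α + 1) (γ := γ + 1) (by positivity) (by linarith)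
      (by push_cast at hγm; linarith) (fun n => by
        have := hγ (n + 1)
        push_cast at this
        rwa [add_assoc, add_comm 1])
    refine ⟨fun z => 1 + α / γ * z * H z, by fun_prop, fun z hz => ?_, ?_⟩
    · rw [← hasSum_nat_add_iff' 1]
      have h := (hs z hz).mul_left ((α : ℂ) / γ * z)
      have hn : ∀ n : ℕ, pochRatio α γ (n + 1) * z ^ (n + 1)
          = α / γ * z * (pochRatio ((α + 1 : ℝ) : ℂ) ((γ + 1 : ℝ) : ℂ) n * z ^ n) := by
        intro n
        rw [pochRatio_succ]
        push_cast
        ring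
      simp only [hn]
      simpa [pochRatio_zero] using h
    -- Multiplied by $(1-x)^\delta$, the summand 1 vanishes in the limit; the factor $\alpha/\gamma$
    -- is absorbed by the functional equation of Gamma.
    · have h1 : Tendsto (fun x : ℝ => (((1 - x) ^ δ : ℝ) : ℂ)) (𝓝[<] 1) (𝓝 0) := by
        have h : ContinuousAt (fun x : ℝ => (((1 - x) ^ δ : ℝ) : ℂ)) 1 :=
          Complex.continuous_ofReal.continuousAt.comp
            ((Real.continuous_rpow_const hδ.le).comp (by fun_prop)).continuousAt
        simpa [hδ.ne'] using h.tendsto.mono_left nhdsWithin_le_nhds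
      have h2 : Tendsto (fun x : ℝ => (α : ℂ) / γ * x) (𝓝[<] 1) (𝓝 (α / γ * 1)) := by
        have h : Continuous (fun x : ℝ => (α : ℂ) / γ * x) := by fun_prop
        simpa using (h.tendsto 1).mono_left nhdsWithin_le_nhds
      have h3 := h1.add (h2.mul ht)
      have e : (0 : ℂ) + α / γ * 1
          * ((Real.Gamma (γ + 1) * Real.Gamma δ / Real.Gamma (α + 1) : ℝ) : ℂ)
          = ((Real.Gamma γ * Real.Gamma δ / Real.Gamma α : ℝ) : ℂ) := by
        have hαC : (α : ℂ) ≠ 0 := by exact_mod_cast hα.ne'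
        have hγC : (γ : ℂ) ≠ 0 := by exact_mod_cast hγ0
        have hG : (Real.Gamma α : ℂ) ≠ 0 := by exact_mod_cast (Real.Gamma_pos_of_pos hα).ne'
        rw [Real.Gamma_add_one hα.ne', Real.Gamma_add_one hγ0]
        push_cast
        field_simp
        ring
      rw [e] at h3
      refine h3.congr fun x => ?_
      ring

/-! ### Continuations of the two hypergeometric functions and their limits below the cut. -/

theorem mem_slitPlane_of_im_neg {z : ℂ} (hz : z.im < 0) : z ∈ Complex.slitPlane :=
  Complex.mem_slitPlane_iff.2 (Or.inr hz.ne)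

theorem cpow_sub_one_mul_self (s : ℂ) {z : ℂ} (hz : z ≠ 0) : z ^ (s - 1) * z = z ^ s := by
  rw [Complex.cpow_sub _ _ hz, Complex.cpow_one, div_mul_cancel₀ _ hz]

/-- With the integrating factor $z^\beta$ the equation reads $(z^\beta f)'=z^{\beta-1}g$, which is
bounded near $x$. -/
theorem exists_tendsto_below_of_mul_deriv {f g : ℂ → ℂ} {β : ℝ}
    (hf : DifferentiableOn ℂ f cutPlane)
    (hd : ∀ z ∈ cutPlane, z * deriv f z + β * f z = g z) {x : ℝ} (hx : 1 < x) {C : ℝ}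
    (hg : ∀ᶠ z in 𝓝[{z : ℂ | z.im < 0}] (x : ℂ), ‖g z‖ ≤ C) :
    ∃ l, Tendsto f (𝓝[{z : ℂ | z.im < 0}] (x : ℂ)) (𝓝 l) := by
  have hxs : (x : ℂ) ∈ Complex.slitPlane := Complex.ofReal_mem_slitPlane.2 (by linarith)
  have hc : ∀ s : ℂ, ContinuousAt (fun z : ℂ => z ^ s) x := fun s =>
    ContinuousAt.cpow continuousAt_id continuousAt_const hxs
  refine exists_tendsto_of_bounded_deriv (m := fun z => z ^ (β : ℂ))
    (d := fun z => z ^ ((β : ℂ) - 1) * g z) (C := (‖(x : ℂ) ^ ((β : ℂ) - 1)‖ + 1) * C) (hc _)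
    (by simp [Complex.cpow_eq_zero_iff, Complex.slitPlane_ne_zero hxs]) ?_ ?_
  · filter_upwards [self_mem_nhdsWithin] with z hz
    have hzs := mem_slitPlane_of_im_neg hz
    have hzc := mem_cutPlane_of_im_neg hz
    have h1 : HasDerivAt (fun z : ℂ => z ^ (β : ℂ)) (β * z ^ ((β : ℂ) - 1)) z := by
      simpa using (hasDerivAt_id z).cpow_const (c := (β : ℂ)) hzs
    have h2 := (hf.differentiableAt (isOpen_cutPlane.mem_nhds hzc)).hasDerivAt
    refine (h1.mul h2).congr_deriv ?_
    rw [← hd z hzc, ← cpow_sub_one_mul_self (β : ℂ) (Complex.slitPlane_ne_zero hzs)]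
    ring
  · have h1 := (hc ((β : ℂ) - 1)).norm.eventually_le_const (lt_add_one _)
    filter_upwards [hg, h1.filter_mono nhdsWithin_le_nhds] with z h2 h3
    rw [norm_mul]
    exact mul_le_mul h3 h2 (norm_nonneg _) (by positivity)

theorem exists_tendsto_below_of_hypergeometric {f : ℂ → ℂ} {α γ δ : ℝ} (hα : α = γ - 1 + δ)
    (hf : DifferentiableOn ℂ f cutPlane)
    (hd : ∀ z ∈ cutPlane, z * (1 - z) * deriv f z = (γ - 1) * (1 - f z) + α * z * f z)
    {x : ℝ} (hx : 1 < x) :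
    ∃ l, Tendsto f (𝓝[{z : ℂ | z.im < 0}] (x : ℂ)) (𝓝 l) := by
  have hxs : (x : ℂ) ∈ Complex.slitPlane := Complex.ofReal_mem_slitPlane.2 (by linarith)
  have hxs1 : (x : ℂ) - 1 ∈ Complex.slitPlane := by
    rw [← Complex.ofReal_one, ← Complex.ofReal_sub]
    exact Complex.ofReal_mem_slitPlane.2 (by linarith)
  have hx0 := Complex.slitPlane_ne_zero hxs
  have hx1 := Complex.slitPlane_ne_zero hxs1
  -- The integrating factor uses $z-1$ rather than $1-z$, so that the principal power is continuous
  -- at $x>1$. The derivative of $mf$ is $(\gamma-1)m/(z(1-z))$, free of $f$.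
  set m : ℂ → ℂ := fun z => z ^ ((γ : ℂ) - 1) * (z - 1) ^ (δ : ℂ) with hm
  have hmc : ContinuousAt m x :=
    (ContinuousAt.cpow continuousAt_id continuousAt_const hxs).mul
      (ContinuousAt.cpow (by fun_prop) continuousAt_const hxs1)
  have hdc : ContinuousAt (fun z : ℂ => m z * (((γ : ℂ) - 1) / (z * (1 - z)))) x :=
    hmc.mul (ContinuousAt.div (by fun_prop) (by fun_prop)
      (mul_ne_zero hx0 (by rw [← neg_sub]; exact neg_ne_zero.2 hx1)))
  refine exists_tendsto_of_bounded_deriv (m := m) (d := _) hmc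
    (by simp [hm, Complex.cpow_eq_zero_iff, hx0, hx1]) ?_
    ((hdc.norm.eventually_le_const (lt_add_one _)).filter_mono nhdsWithin_le_nhds)
  filter_upwards [self_mem_nhdsWithin] with z hz
  have hzs := mem_slitPlane_of_im_neg hz
  have hzs1 : z - 1 ∈ Complex.slitPlane := mem_slitPlane_of_im_neg (by simpa using hz)
  have hzc := mem_cutPlane_of_im_neg hz
  have hz0 := Complex.slitPlane_ne_zero hzs
  have hz1 := Complex.slitPlane_ne_zero hzs1
  have hz1' : 1 - z ≠ 0 := by
    rw [← neg_sub]
    exact neg_ne_zero.2 hz1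
  have h1 : HasDerivAt (fun z : ℂ => z ^ ((γ : ℂ) - 1))
      (((γ : ℂ) - 1) * z ^ ((γ : ℂ) - 1 - 1)) z := by
    simpa using (hasDerivAt_id z).cpow_const (c := (γ : ℂ) - 1) hzs
  have h2 : HasDerivAt (fun z : ℂ => (z - 1) ^ (δ : ℂ)) (δ * (z - 1) ^ ((δ : ℂ) - 1)) z := by
    simpa using ((hasDerivAt_id z).sub_const 1).cpow_const (c := (δ : ℂ)) hzs1
  have h3 := (hf.differentiableAt (isOpen_cutPlane.mem_nhds hzc)).hasDerivAt
  refine ((h1.mul h2).mul h3).congr_deriv ?_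
  have hd' := hd z hzc
  simp only [hm, Pi.mul_apply]
  rw [← cpow_sub_one_mul_self ((γ : ℂ) - 1) hz0, ← cpow_sub_one_mul_self (δ : ℂ) hz1]
  rw [hα] at hd'
  push_cast at hd'
  have hz2 : z * (1 - z) ≠ 0 := mul_ne_zero hz0 hz1'
  rw [mul_div_assoc', eq_div_iff hz2]
  linear_combination (z ^ ((γ : ℂ) - 1 - 1) * z * (z - 1) ^ ((δ : ℂ) - 1) * (z - 1)) * hd'

/-- The continuation is $b\int_0^1t^{b-1}(1-tz)^{-a-b}dt$: averaging multiplies the binomial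
coefficients by $b/(b+n)=(b)_n/(1+b)_n$. The differential equation says that $z^bF/b$ is a primitive
of $z^{b-1}(1-z)^{-a-b}$. -/
theorem exists_branch_gauss (a : ℝ) {b : ℝ} (hb : 0 < b) : ∃ F : ℂ → ℂ,
    DifferentiableOn ℂ F cutPlane ∧
    (∀ z : ℂ, ‖z‖ < 1 → F z = ordinaryHypergeometric (b : ℂ) (a + b : ℂ) (1 + b : ℂ) z) ∧
    (∀ z ∈ cutPlane, z * deriv F z + b * F z = b * (1 - z) ^ (-(a + b : ℂ))) ∧
    ∀ x : ℝ, 1 < x → ∃ l, Tendsto F (𝓝[{z : ℂ | z.im < 0}] (x : ℂ)) (𝓝 l) := by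
  set g : ℂ → ℂ := fun w => (1 - w) ^ (-(a + b : ℂ)) with hg
  have hgd : DifferentiableOn ℂ g cutPlane := differentiableOn_one_sub_cpow _
  obtain ⟨F, hF⟩ : ∃ F : ℂ → ℂ, F = fun z => (b : ℂ) * betaTransform b 1 g z := ⟨_, rfl⟩
  have hd : DifferentiableOn ℂ F cutPlane := by
    rw [hF]
    exact (differentiableOn_betaTransform hb one_pos hgd).const_mul _
  have hbn : ∀ n : ℕ, (b : ℂ) + n ≠ 0 := add_natCast_ne_zero fun n => by positivity
  have hs : ∀ z : ℂ, ‖z‖ < 1 → HasSum (fun n : ℕ =>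
      (b : ℂ) * ((ascPochhammer ℂ n).eval (a + b : ℂ) / (n.factorial : ℂ)) / (b + n) * z ^ n)
      (F z) := by
    intro z hz
    rw [hF]
    have h := (hasSum_betaTransform hb one_pos
      (fun w hw => hasSum_one_sub_cpow_neg (a + b : ℂ) hw) hz).mul_left (b : ℂ)
    have hn : ∀ n : ℕ, (b : ℂ) * ((ascPochhammer ℂ n).eval (a + b : ℂ) / (n.factorial : ℂ))
        / (b + n) * z ^ n = b * ((ascPochhammer ℂ n).eval (a + b : ℂ) / (n.factorial : ℂ)
          * (ProbabilityTheory.beta (b + n) 1 : ℝ) * z ^ n) := by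
      intro n
      rw [ProbabilityTheory.beta_one_right (by positivity)]
      push_cast
      ring
    simp only [hn]
    exact h
  have ho : ∀ z ∈ cutPlane, z * deriv F z + b * F z = b * g z := by
    intro z hz
    refine mul_deriv_add_of_coeff hd (hgd.const_mul (b : ℂ)) hs
      (fun w hw => by
        simpa only [← mul_assoc] using
          (hasSum_one_sub_cpow_neg (a + b : ℂ) hw).mul_left (b : ℂ))
      (fun n => ?_) hz
    rw [div_mul_cancel₀ _ (hbn n)]
  refine ⟨F, hd, fun z hz => ?_, ho, fun x hx => ?_⟩
  · rw [ordinaryHypergeometric_eq_tsum, ← (hs z hz).tsum_eq]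
    refine tsum_congr fun n => ?_
    have h1 : (ascPochhammer ℂ n).eval (b : ℂ) * (b + n)
        = b * (ascPochhammer ℂ n).eval (1 + b : ℂ) := by
      rw [← ascPochhammer_succ_eval, ascPochhammer_succ_left]
      simp [Polynomial.eval_comp, add_comm]
    have h2 : (ascPochhammer ℂ n).eval (1 + b : ℂ) ≠ 0 :=
      ascPochhammer_eval_ne_zero (fun n => by
        have := hbn (n + 1)
        push_cast at this
        rwa [add_comm (1 : ℂ), add_assoc, add_comm (1 : ℂ)]) n
    have h3 : (n.factorial : ℂ) ≠ 0 := by exact_mod_cast n.factorial_ne_zero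
    have h4 := hbn n
    have h5 : (b : ℂ) / (b + n) = (ascPochhammer ℂ n).eval (b : ℂ)
        / (ascPochhammer ℂ n).eval (1 + b : ℂ) := by
      rw [div_eq_div_iff h4 h2, h1]
    rw [smul_eq_mul, mul_div_right_comm, h5]
    field_simp
  · have hx1 : ‖(1 : ℂ) - x‖ ≠ 0 := by
      rw [norm_ne_zero_iff, sub_ne_zero]
      exact_mod_cast hx.ne
    have hc : ContinuousAt (fun z : ℂ => b * ‖1 - z‖ ^ (-(a + b))) x :=
      ContinuousAt.mul continuousAt_const (ContinuousAt.rpow_const (by fun_prop) (Or.inl hx1))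
    refine exists_tendsto_below_of_mul_deriv hd ho hx (C := b * ‖1 - (x : ℂ)‖ ^ (-(a + b)) + 1) ?_
    filter_upwards [(hc.eventually_le_const (lt_add_one _)).filter_mono nhdsWithin_le_nhds]
      with z hz
    rw [norm_mul, Complex.norm_real, Real.norm_of_nonneg hb.le, hg]
    simp only
    rw [← Complex.ofReal_add, ← Complex.ofReal_neg, Complex.norm_cpow_real]
    exact hz

/-- Since $(1)_n/(2)_n=1/(1+n)$, the ${}_3F_2$ is the plain average $G(z)=\int_0^1H(tz)\,dt$ of
$H={}_2F_1(1,1+a;2-b;\cdot)$, so $zG$ is a primitive of $H$. The exponent of $H$ at 1 is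
$\delta=(1+a)-(2-b)+1=a+b$. -/
theorem exists_branch_hypergeometric {a b : ℝ} (ha : 0 < a) (hb : 0 < b)
    (hbn : ∀ n : ℕ, b ≠ n) : ∃ G H : ℂ → ℂ,
    DifferentiableOn ℂ G cutPlane ∧ DifferentiableOn ℂ H cutPlane ∧
    (∀ z : ℂ, ‖z‖ < 1 → G z = hypSeries [1, 1, 1 + a] [2, 2 - b] z) ∧
    (∀ z ∈ cutPlane, z * deriv G z + G z = H z) ∧
    (∀ z ∈ cutPlane, z * (1 - z) * deriv H z = (1 - b) * (1 - H z) + (1 + a) * z * H z) ∧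
    (∀ x : ℝ, 1 < x → ∃ l, Tendsto G (𝓝[{z : ℂ | z.im < 0}] (x : ℂ)) (𝓝 l)) ∧
    Tendsto (fun x : ℝ => (((1 - x) ^ (a + b) : ℝ) : ℂ) * H x) (𝓝[<] 1)
      (𝓝 ((Real.Gamma (2 - b) * Real.Gamma (a + b) / Real.Gamma (1 + a) : ℝ) : ℂ)) := by
  have hγ : ∀ n : ℕ, 2 - b + n ≠ 0 := by
    intro n h
    apply hbn (n + 2)
    push_cast
    linarith
  obtain ⟨m, hm⟩ := exists_nat_gt b
  obtain ⟨H, hd, hs, ht⟩ := exists_hypergeometric_one (δ := a + b) (by positivity) m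
    (α := 1 + a) (γ := 2 - b) (by positivity) (by ring) (by linarith) hγ
  have hode : ∀ z ∈ cutPlane, z * (1 - z) * deriv H z
      = (((2 - b : ℝ) : ℂ) - 1) * (1 - H z) + ((1 + a : ℝ) : ℂ) * z * H z := by
    intro z hz
    have h := deriv_eq_of_coeff_ratio hd hs
      (pochRatio_succ_mul ((1 + a : ℝ) : ℂ) (add_natCast_ne_zero hγ)) hz
    rwa [pochRatio_zero] at h
  have hlim : ∀ x : ℝ, 1 < x → ∃ l, Tendsto H (𝓝[{z : ℂ | z.im < 0}] (x : ℂ)) (𝓝 l) :=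
    fun x hx => exists_tendsto_below_of_hypergeometric (δ := a + b) (by ring) hd hode hx
  have hGd := differentiableOn_betaTransform one_pos one_pos hd
  have hGs : ∀ z : ℂ, ‖z‖ < 1 → HasSum (fun n : ℕ =>
      pochRatio ((1 + a : ℝ) : ℂ) ((2 - b : ℝ) : ℂ) n / (1 + n) * z ^ n)
      (betaTransform 1 1 H z) := by
    intro z hz
    have h := hasSum_betaTransform one_pos one_pos hs hz
    have hn : ∀ n : ℕ, ((ProbabilityTheory.beta (1 + n) 1 : ℝ) : ℂ) = 1 / (1 + n) := by
      intro n
      rw [ProbabilityTheory.beta_one_right (by positivity)]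
      push_cast
      rfl
    simpa only [hn, mul_one_div] using h
  have hn1 : ∀ n : ℕ, (1 : ℂ) + n ≠ 0 := fun n => by
    exact_mod_cast (by omega : 1 + n ≠ 0)
  have hGo : ∀ z ∈ cutPlane, z * deriv (betaTransform 1 1 H) z + ((1 : ℝ) : ℂ)
      * betaTransform 1 1 H z = H z := fun z hz =>
    mul_deriv_add_of_coeff hGd hd hGs hs (fun n => by
      rw [Complex.ofReal_one, div_mul_cancel₀ _ (hn1 n)]) hz
  refine ⟨betaTransform 1 1 H, H, hGd, hd, fun z hz => ?_, ?_, ?_, fun x hx => ?_, ht⟩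
  · rw [hypSeries, ← (hGs z hz).tsum_eq]
    refine tsum_congr fun n => ?_
    have h1 : (ascPochhammer ℂ n).eval (1 : ℂ) = n.factorial := ascPochhammer_eval_one ℂ n
    have h2 : (ascPochhammer ℂ n).eval (2 : ℂ) = n.factorial * (1 + n) := by
      have h := ascPochhammer_succ_eval n (1 : ℂ)
      rw [ascPochhammer_succ_left] at h
      simp only [Polynomial.eval_mul, Polynomial.eval_X, Polynomial.eval_comp,
        Polynomial.eval_add, Polynomial.eval_one, one_mul, h1] at h
      rw [← h]
      norm_num
    have h3 : (n.factorial : ℂ) ≠ 0 := by exact_mod_cast n.factorial_ne_zero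
    have h4 := hn1 n
    have h5 := ascPochhammer_eval_ne_zero (add_natCast_ne_zero hγ) n
    push_cast at h5
    simp only [List.map_cons, List.map_nil, List.prod_cons, List.prod_nil, mul_one, h1, h2,
      pochRatio]
    push_cast
    field_simp
  · simpa using hGo
  · intro z hz
    rw [hode z hz]
    push_cast
    ring
  · obtain ⟨l, hl⟩ := hlim x hx
    exact exists_tendsto_below_of_mul_deriv hGd hGo hx
      (hl.norm.eventually_le_const (lt_add_one _))

/-! ### The connection formula on the doubly cut plane. -/

theorem mem_slitPlane_iff_one_sub {z : ℂ} : z ∈ Complex.slitPlane ↔ 1 - z ∈ cutPlane := by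
  rw [mem_cutPlane_iff_one_sub, sub_sub_cancel]

theorem isOpen_slitPlane_inter_cutPlane : IsOpen (Complex.slitPlane ∩ cutPlane) :=
  Complex.isOpen_slitPlane.inter isOpen_cutPlane

theorem ofReal_mem_slitPlane_inter_cutPlane {x : ℝ} (h0 : 0 < x) (h1 : x < 1) :
    (x : ℂ) ∈ Complex.slitPlane ∩ cutPlane :=
  ⟨Complex.ofReal_mem_slitPlane.2 h0, by simpa [cutPlane] using h1⟩

/-- The plane without $(-\infty,0]$ and $[1,\infty)$ is star-shaped about $1/2$. -/
theorem isPreconnected_slitPlane_inter_cutPlane :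
    IsPreconnected (Complex.slitPlane ∩ cutPlane) := by
  have h : StarConvex ℝ ((1 / 2 : ℝ) : ℂ) (Complex.slitPlane ∩ cutPlane) := by
    intro z hz s t hs ht hst
    rw [Set.mem_inter_iff, Complex.mem_slitPlane_iff, cutPlane, Set.mem_ofPred_eq] at hz ⊢
    simp only [Complex.real_smul, Complex.add_re, Complex.add_im, Complex.mul_re, Complex.mul_im,
      Complex.ofReal_re, Complex.ofReal_im, zero_mul, mul_zero, sub_zero, add_zero, zero_add]
    by_cases h : t * z.im = 0
    · rcases mul_eq_zero.1 h with h1 | h1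
      · have h2 : s = 1 := by linarith
        rw [h1, h2]
        norm_num
      · have h2 : 0 < z.re := hz.1.resolve_right (fun h => h h1)
        have h3 : z.re < 1 := not_le.1 fun h => hz.2 ⟨h1, h⟩
        refine ⟨Or.inl ?_, fun h4 => ?_⟩
        · rcases hs.eq_or_lt with h5 | h5
          · have : t = 1 := by linarith
            rw [← h5, this]
            linarith
          · have := mul_nonneg ht h2.le
            linarith
        · rcases ht.eq_or_lt with h5 | h5
          · have : s = 1 := by linarith
            rw [← h5, this] at h4
            linarith [h4.2]
          · have := mul_lt_mul_of_pos_left h3 h5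
            linarith [h4.2]
    · exact ⟨Or.inr h, fun h4 => h h4.1⟩
  exact (h.isPathConnected
    (ofReal_mem_slitPlane_inter_cutPlane (by norm_num) (by norm_num))).isConnected.isPreconnected

/-- Here $K(z)=\int_0^1t^a(1-t)^{b-1}(1-tz)^{-1}dt$, whose Taylor coefficients $B(a+1+n,b)$ have the
ratio $(a+1+n)/(a+b+1+n)$. -/
theorem exists_stieltjes {a b : ℝ} (ha : 0 < a) (hb : 0 < b) : ∃ K : ℂ → ℂ,
    DifferentiableOn ℂ K cutPlane ∧
    (∀ z ∈ cutPlane, z * (1 - z) * deriv K z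
      = (a + b) * (ProbabilityTheory.beta (a + 1) b - K z) + (1 + a) * z * K z) ∧
    ∀ z ∈ cutPlane, HasDerivAt (betaTransform a b fun w => Complex.log (1 - w)) (-K z) z := by
  have ha1 : 0 < a + 1 := by positivity
  have hgd : DifferentiableOn ℂ (fun w : ℂ => (1 - w) ^ (-(1 : ℂ))) cutPlane :=
    differentiableOn_one_sub_cpow _
  have hd := differentiableOn_betaTransform ha1 hb hgd
  refine ⟨_, hd, ?_, ?_⟩
  · intro z hz
    have hs : ∀ z : ℂ, ‖z‖ < 1 → HasSum (fun n : ℕ =>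
        ((ProbabilityTheory.beta (a + 1 + n) b : ℝ) : ℂ) * z ^ n)
        (betaTransform (a + 1) b (fun w : ℂ => (1 - w) ^ (-(1 : ℂ))) z) := by
      intro z hz
      have h := hasSum_betaTransform ha1 hb (fun w hw => hasSum_one_sub_cpow_neg 1 hw) hz
      have h1 : ∀ n : ℕ, (ascPochhammer ℂ n).eval (1 : ℂ) / (n.factorial : ℂ) = 1 := by
        intro n
        rw [ascPochhammer_eval_one, div_self]
        exact_mod_cast n.factorial_ne_zero
      simpa only [h1, one_mul] using h
    have h := deriv_eq_of_coeff_ratio (α := ((1 + a : ℝ) : ℂ)) (γ := ((1 + a + b : ℝ) : ℂ)) hd hs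
      (fun n => by
        have h1 := ProbabilityTheory.beta_add_one_mul (p := a + 1 + n) (by positivity) hb
        have h2 := congrArg (fun x : ℝ => (x : ℂ)) h1
        push_cast at h2 ⊢
        rw [← add_assoc]
        linear_combination h2) hz
    rw [h, Nat.cast_zero, add_zero]
    push_cast
    ring
  · intro z hz
    have hlog : DifferentiableOn ℂ (fun w => Complex.log (1 - w)) cutPlane := fun w hw =>
      (DifferentiableAt.clog (by fun_prop)
        (mem_cutPlane_iff_one_sub.1 hw)).differentiableWithinAt
    refine (hasDerivAt_betaTransform ha hb hlog hz).congr_deriv ?_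
    rw [betaTransform, betaTransform, ← integral_neg]
    refine setIntegral_congr_fun measurableSet_Ioo fun t ht => ?_
    have hw := mul_mem_cutPlane ht.1.le ht.2.le hz
    have h1 : HasDerivAt (fun w => Complex.log (1 - w)) (-1 / (1 - t * z)) (t * z) :=
      ((hasDerivAt_id _).const_sub 1).clog (mem_cutPlane_iff_one_sub.1 hw)
    rw [h1.deriv, Complex.cpow_neg_one]
    ring

theorem eqOn_const_of_hasDerivAt_zero {f : ℂ → ℂ} {s : Set ℂ} (hs : IsOpen s)
    (hc : IsPreconnected s) (hf : ∀ z ∈ s, HasDerivAt f 0 z) {x y : ℂ} (hx : x ∈ s) (hy : y ∈ s) :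
    f x = f y :=
  hs.is_const_of_deriv_eq_zero hc
    (fun z hz => (hf z hz).differentiableAt.differentiableWithinAt)
    (fun z hz => (hf z hz).deriv) hx hy

/-- Connection formula between the expansions at `0` and at `1`. -/
theorem connection_formula {a b : ℝ} (ha : 0 < a) (hb : 0 < b) (hb1 : b ≠ 1) {K H : ℂ → ℂ} {k l : ℂ}
    (hK : DifferentiableOn ℂ K cutPlane)
    (hKd : ∀ z ∈ cutPlane, z * (1 - z) * deriv K z = (a + b) * (k - K z) + (1 + a) * z * K z)
    (hH : DifferentiableOn ℂ H cutPlane)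
    (hHd : ∀ z ∈ cutPlane, z * (1 - z) * deriv H z = (1 - b) * (1 - H z) + (1 + a) * z * H z)
    (hHl : Tendsto (fun x : ℝ => (((1 - x) ^ (a + b) : ℝ) : ℂ) * H x) (𝓝[<] 1) (𝓝 l))
    {z : ℂ} (hz : z ∈ Complex.slitPlane ∩ cutPlane) :
    K (1 - z) + (a + b) * k / (1 - b) * H z
      = (a + b) * k / (1 - b) * l * (z ^ ((b : ℂ) - 1) * (1 - z) ^ (-(a + b : ℂ))) := by
  have hb1' : (1 : ℂ) - b ≠ 0 := by
    rw [sub_ne_zero]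
    exact_mod_cast hb1.symm
  -- Chosen so that the constant terms of the equations for $K(1-z)$ and $A\,H(z)$ cancel; the sum
  -- then solves the homogeneous equation and $\varphi$ is constant.
  set A : ℂ := (a + b) * k / (1 - b) with hA
  have hA' : A * (1 - b) = (a + b) * k := by rw [hA, div_mul_cancel₀ _ hb1']
  set φ : ℂ → ℂ := fun z => z ^ ((1 : ℂ) - b) * (1 - z) ^ (a + b : ℂ) * (K (1 - z) + A * H z)
    with hφ
  have hderiv : ∀ z ∈ Complex.slitPlane ∩ cutPlane, HasDerivAt φ 0 z := by
    rintro z ⟨hzs, hzc⟩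
    have hz1s := mem_cutPlane_iff_one_sub.1 hzc
    have hz1c := mem_slitPlane_iff_one_sub.1 hzs
    have h1 : HasDerivAt (fun z : ℂ => z ^ ((1 : ℂ) - b))
        (((1 : ℂ) - b) * z ^ ((1 : ℂ) - b - 1)) z := by
      simpa using (hasDerivAt_id z).cpow_const (c := (1 : ℂ) - b) hzs
    have h2 : HasDerivAt (fun z : ℂ => (1 - z) ^ (a + b : ℂ))
        (-((a + b : ℂ) * (1 - z) ^ ((a + b : ℂ) - 1))) z := by
      simpa using ((hasDerivAt_id z).const_sub 1).cpow_const (c := (a + b : ℂ)) hz1s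
    have h3 : HasDerivAt (fun z => K (1 - z)) (-deriv K (1 - z)) z := by
      have h := (hK.differentiableAt (isOpen_cutPlane.mem_nhds hz1c)).hasDerivAt
      have h' := HasDerivAt.comp z h ((hasDerivAt_id z).const_sub 1)
      simpa [Function.comp_def] using h'
    have h4 := (hH.differentiableAt (isOpen_cutPlane.mem_nhds hzc)).hasDerivAt
    refine ((h1.mul h2).mul (h3.add (h4.const_mul A))).congr_deriv ?_
    have hK' := hKd _ hz1c
    have hH' := hHd _ hzc
    simp only [Pi.mul_apply, Pi.add_apply]
    rw [← cpow_sub_one_mul_self ((1 : ℂ) - b) (Complex.slitPlane_ne_zero hzs),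
      ← cpow_sub_one_mul_self (a + b : ℂ) (Complex.slitPlane_ne_zero hz1s)]
    linear_combination (z ^ ((1 : ℂ) - b - 1) * (1 - z) ^ ((a + b : ℂ) - 1))
      * (A * hH' - hK' + hA')
  have hconst : ∀ w ∈ Complex.slitPlane ∩ cutPlane, φ w = φ z := fun w hw =>
    eqOn_const_of_hasDerivAt_zero isOpen_slitPlane_inter_cutPlane
      isPreconnected_slitPlane_inter_cutPlane hderiv hw hz
  -- As $x\to1$, $K(1-x)$ stays bounded and is killed by $(1-x)^{a+b}$, so only the singularity of
  -- $H$ contributes.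
  have hlim : Tendsto (fun x : ℝ => φ x) (𝓝[<] 1) (𝓝 (A * l)) := by
    have h1 : Tendsto (fun x : ℝ => (x : ℂ) ^ ((1 : ℂ) - b)) (𝓝[<] 1) (𝓝 1) := by
      have h : ContinuousAt (fun x : ℝ => (x : ℂ) ^ ((1 : ℂ) - b)) 1 :=
        ContinuousAt.cpow Complex.continuous_ofReal.continuousAt continuousAt_const (by simp)
      simpa using h.tendsto.mono_left nhdsWithin_le_nhds
    have h2 : Tendsto (fun x : ℝ => (((1 - x) ^ (a + b) : ℝ) : ℂ)) (𝓝[<] 1) (𝓝 0) := by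
      have h : ContinuousAt (fun x : ℝ => (((1 - x) ^ (a + b) : ℝ) : ℂ)) 1 :=
        Complex.continuous_ofReal.continuousAt.comp ((Real.continuous_rpow_const
          (by positivity)).comp (by fun_prop)).continuousAt
      simpa [(add_pos ha hb).ne'] using h.tendsto.mono_left nhdsWithin_le_nhds
    have h3 : Tendsto (fun x : ℝ => K (1 - x)) (𝓝[<] 1) (𝓝 (K 0)) := by
      have hK0 : ContinuousAt K (1 - ((1 : ℝ) : ℂ)) :=
        (hK.differentiableAt (isOpen_cutPlane.mem_nhds (by simp [cutPlane]))).continuousAt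
      have h : ContinuousAt (fun x : ℝ => K (1 - x)) 1 :=
        ContinuousAt.comp (f := fun x : ℝ => (1 : ℂ) - x) hK0 (by fun_prop)
      simpa using h.tendsto.mono_left nhdsWithin_le_nhds
    have h4 := h1.mul ((h2.mul h3).add (hHl.const_mul A))
    simp only [zero_mul, zero_add, one_mul] at h4
    refine h4.congr' ?_
    filter_upwards [self_mem_nhdsWithin] with x hx
    simp only [hφ]
    rw [Complex.ofReal_cpow (sub_nonneg.2 (le_of_lt hx))]
    push_cast
    ring
  have hval : φ z = A * l := by
    refine tendsto_nhds_unique (tendsto_const_nhds.congr' ?_) hlim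
    filter_upwards [Ioo_mem_nhdsLT zero_lt_one] with x hx
    exact (hconst x (ofReal_mem_slitPlane_inter_cutPlane hx.1 hx.2)).symm
  have hz0 := Complex.slitPlane_ne_zero hz.1
  have hz1 := Complex.slitPlane_ne_zero (mem_cutPlane_iff_one_sub.1 hz.2)
  have e1 : z ^ ((1 : ℂ) - b) * z ^ ((b : ℂ) - 1) = 1 := by
    rw [← Complex.cpow_add _ _ hz0]
    simp
  have e2 : (1 - z) ^ (a + b : ℂ) * (1 - z) ^ (-(a + b : ℂ)) = 1 := by
    rw [← Complex.cpow_add _ _ hz1]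
    simp
  rw [← hval, hφ]
  simp only
  linear_combination (-(K (1 - z) + A * H z)) * (e1 + z ^ ((1 : ℂ) - b) * z ^ ((b : ℂ) - 1) * (e2))

/-! ### The logarithmic Beta integral and the change of variables in the rate. -/

theorem integrableOn_betaWeight_mul_log {a b : ℝ} (ha : 0 < a) (hb : 0 < b) :
    IntegrableOn (fun t => betaWeight a b t * Real.log (1 - t)) (Set.Ioo 0 1) := by
  -- Half of the exponent $b$ is spent on bounding the logarithm, the other half keeps the weight
  -- integrable at 1.
  have hb2 : 0 < b / 2 := by positivity
  refine Integrable.mono' ((integrableOn_betaWeight ha hb2).mul_const (1 / (b / 2)))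
    (ContinuousOn.aestronglyMeasurable ((continuousOn_betaWeight a b).mul ?_) measurableSet_Ioo) ?_
  · exact ContinuousOn.log (by fun_prop) fun t ht => (sub_pos.2 ht.2).ne'
  · filter_upwards [ae_restrict_mem measurableSet_Ioo] with t ht
    have ht1 : 0 < 1 - t := sub_pos.2 ht.2
    have e : betaWeight a b t * Real.log (1 - t)
        = betaWeight a (b / 2) t * (Real.log (1 - t) * (1 - t) ^ (b / 2)) := by
      rw [betaWeight, betaWeight, show b - 1 = (b / 2 - 1) + b / 2 by ring, Real.rpow_add ht1]
      ring
    rw [e, norm_mul, Real.norm_of_nonneg (betaWeight_nonneg _ _ ht)]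
    refine mul_le_mul_of_nonneg_left ?_ (betaWeight_nonneg _ _ ht)
    exact (Real.abs_log_mul_self_rpow_lt _ _ ht1 (by linarith [ht.1]) hb2).le

theorem one_sub_mul_pos {θ t : ℝ} (hθ : 0 < θ) (ht : t ∈ Set.Ioo (0 : ℝ) 1) :
    0 < 1 - t * (1 - θ) := by
  nlinarith [ht.1, ht.2, mul_pos hθ ht.1]

theorem log_one_sub_ofReal {θ t : ℝ} (hθ : 0 < θ) (ht : t ∈ Set.Ioo (0 : ℝ) 1) :
    Complex.log (1 - t * (1 - θ)) = (Real.log (1 - t * (1 - θ)) : ℝ) := by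
  rw [Complex.ofReal_log (one_sub_mul_pos hθ ht).le]
  push_cast
  rfl

theorem betaTransform_log_ofReal (a b : ℝ) {θ : ℝ} (hθ : 0 < θ) :
    betaTransform a b (fun w => Complex.log (1 - w)) (1 - θ)
      = (∫ t in Set.Ioo (0 : ℝ) 1, betaWeight a b t * Real.log (1 - t * (1 - θ)) : ℝ) := by
  rw [betaTransform, ← integral_complex_ofReal]
  refine setIntegral_congr_fun measurableSet_Ioo fun t ht => ?_
  rw [log_one_sub_ofReal hθ ht, Complex.ofReal_mul]

theorem one_sub_ofReal_mem_cutPlane {θ : ℝ} (hθ : 0 < θ) : (1 : ℂ) - θ ∈ cutPlane :=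
  mem_slitPlane_iff_one_sub.1 (Complex.ofReal_mem_slitPlane.2 hθ)

theorem integrableOn_betaWeight_mul_log_one_sub {a b θ : ℝ} (ha : 0 < a) (hb : 0 < b)
    (hθ : 0 < θ) :
    IntegrableOn (fun t => betaWeight a b t * Real.log (1 - t * (1 - θ))) (Set.Ioo 0 1) := by
  have hlog : ContinuousOn (fun w => Complex.log (1 - w)) cutPlane := fun w hw =>
    (ContinuousAt.clog (by fun_prop) (mem_cutPlane_iff_one_sub.1 hw)).continuousWithinAt
  have h := (integrableOn_betaTransform ha hb hlog (one_sub_ofReal_mem_cutPlane hθ)).re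
  refine IntegrableOn.congr_fun h (fun t ht => ?_) measurableSet_Ioo
  rw [log_one_sub_ofReal hθ ht, ← Complex.ofReal_mul]
  rfl

/-- For $0<x<1$ one has $1-t\le1-t(1-x)\le1$, so $|\log(1-t)|$ dominates. -/
theorem tendsto_integral_log {a b : ℝ} (ha : 0 < a) (hb : 0 < b) :
    Tendsto (fun x : ℝ => ∫ t in Set.Ioo (0 : ℝ) 1, betaWeight a b t * Real.log (1 - t * (1 - x)))
      (𝓝[>] 0) (𝓝 (∫ t in Set.Ioo (0 : ℝ) 1, betaWeight a b t * Real.log (1 - t))) := by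
  refine tendsto_integral_filter_of_dominated_convergence
    (fun t => ‖betaWeight a b t * Real.log (1 - t)‖) ?_ ?_
    (integrableOn_betaWeight_mul_log ha hb).norm ?_
  · filter_upwards [self_mem_nhdsWithin] with x hx
    exact (integrableOn_betaWeight_mul_log_one_sub ha hb hx).aestronglyMeasurable
  · filter_upwards [Ioo_mem_nhdsGT zero_lt_one] with x hx
    filter_upwards [ae_restrict_mem measurableSet_Ioo] with t ht
    rw [norm_mul, norm_mul]
    refine mul_le_mul_of_nonneg_left ?_ (norm_nonneg _)
    have h1 : 0 < 1 - t := sub_pos.2 ht.2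
    have h2 : 1 - t ≤ 1 - t * (1 - x) := by nlinarith [mul_pos ht.1 hx.1]
    have h3 : 1 - t * (1 - x) ≤ 1 := by nlinarith [mul_pos ht.1 (sub_pos.2 hx.2)]
    rw [Real.norm_of_nonpos (Real.log_nonpos (h1.le.trans h2) h3),
      Real.norm_of_nonpos (Real.log_nonpos h1.le (h2.trans h3))]
    exact neg_le_neg (Real.log_le_log h1 h2)
  · filter_upwards [ae_restrict_mem measurableSet_Ioo] with t ht
    have h1 : 0 < 1 - t := sub_pos.2 ht.2
    have hc : ContinuousAt (fun x : ℝ => betaWeight a b t * Real.log (1 - t * (1 - x))) 0 :=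
      ContinuousAt.mul continuousAt_const (ContinuousAt.log (by fun_prop) (by simp [h1.ne']))
    simpa using hc.tendsto.mono_left nhdsWithin_le_nhds

/-- Under $x=\theta t/(1-t)$ with $\theta=P/\chi$ the SINR density becomes a Beta density, and
$1+x=(1-t(1-\theta))/(1-t)$ splits the logarithm. -/
theorem sinrPDF_comp_eq {P χ a b t : ℝ} {ρ χ₁ : ℝ} (hP : ρ * χ₁ = P) (hP0 : 0 < P) (hχ : 0 < χ)
    (ht : t ∈ Set.Ioo (0 : ℝ) 1) :
    |P / χ / (1 - t) ^ 2| * (Real.logb 2 (1 + P / χ * (t / (1 - t)))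
        * sinrPDF ρ a χ₁ b χ (P / χ * (t / (1 - t))))
      = Real.Gamma (a + b) / (Real.Gamma a * Real.Gamma b * Real.log 2)
        * (betaWeight a b t * Real.log (1 - t * (1 - P / χ))
          - betaWeight a b t * Real.log (1 - t)) := by
  have ht0 := ht.1
  have ht1 : 0 < 1 - t := sub_pos.2 ht.2
  have hθ : 0 < P / χ := div_pos hP0 hχ
  have hpos := one_sub_mul_pos hθ ht
  have h1 : 1 + P / χ * (t / (1 - t)) = (1 - t * (1 - P / χ)) / (1 - t) := by
    field_simp
    ring
  have h2 : 1 / χ + P / χ * (t / (1 - t)) / P = (χ * (1 - t))⁻¹ := by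
    field_simp
    ring
  have h3 : (P / χ * (t / (1 - t))) ^ (a - 1)
      = P ^ (a - 1) * t ^ (a - 1) / (χ ^ (a - 1) * (1 - t) ^ (a - 1)) := by
    rw [Real.mul_rpow hθ.le (by positivity), Real.div_rpow hP0.le hχ.le,
      Real.div_rpow ht0.le ht1.le]
    field_simp
  have h4 : ((χ * (1 - t))⁻¹) ^ (-a - b)
      = χ ^ (a - 1) * χ * χ ^ b * ((1 - t) ^ (a - 1) * (1 - t) ^ (b - 1) * (1 - t) ^ 2) := by
    rw [Real.inv_rpow (by positivity), ← Real.rpow_neg (by positivity),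
      show -(-a - b) = (a - 1) + 1 + b by ring, Real.mul_rpow hχ.le ht1.le,
      Real.rpow_add hχ, Real.rpow_add_one hχ.ne',
      show a - 1 + 1 + b = (a - 1) + (b - 1) + (2 : ℕ) by push_cast; ring,
      Real.rpow_add_natCast ht1.ne', Real.rpow_add ht1]
  have h5 : P ^ a = P ^ (a - 1) * P := by
    rw [← Real.rpow_add_one hP0.ne', sub_add_cancel]
  have hP' : 0 < P ^ (a - 1) := Real.rpow_pos_of_pos hP0 _
  have hχ' : 0 < χ ^ (a - 1) := Real.rpow_pos_of_pos hχ _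
  have hχ'' : 0 < χ ^ b := Real.rpow_pos_of_pos hχ _
  have ht' : 0 < (1 - t) ^ (a - 1) := Real.rpow_pos_of_pos ht1 _
  have hl : Real.log 2 ≠ 0 := (Real.log_pos one_lt_two).ne'
  rw [sinrPDF, hP, h2, h3, h4, h5, h1, Real.logb, Real.log_div hpos.ne' ht1.ne',
    abs_of_pos (by positivity), betaWeight]
  field_simp

theorem rate_change_of_variables {ρ a χ₁ b χ : ℝ} (hρ : 0 < ρ) (ha : 0 < a) (hχ₁ : 0 < χ₁)
    (hb : 0 < b) (hχ : 0 < χ) :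
    IntegrableOn (fun x => Real.logb 2 (1 + x) * sinrPDF ρ a χ₁ b χ x) (Set.Ioi 0) ∧
    achievableRate ρ a χ₁ b χ = Real.Gamma (a + b) / (Real.Gamma a * Real.Gamma b * Real.log 2)
      * ((∫ t in Set.Ioo (0 : ℝ) 1, betaWeight a b t * Real.log (1 - t * (1 - ρ * χ₁ / χ)))
        - ∫ t in Set.Ioo (0 : ℝ) 1, betaWeight a b t * Real.log (1 - t)) := by
  have hP : 0 < ρ * χ₁ := mul_pos hρ hχ₁
  set θ := ρ * χ₁ / χ with hθdef
  have hθ : 0 < θ := div_pos hP hχ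
  have himage : (fun t : ℝ => θ * (t / (1 - t))) '' Set.Ioo 0 1 = Set.Ioi 0 := by
    ext x
    simp only [Set.mem_image, Set.mem_Ioo, Set.mem_Ioi]
    constructor
    · rintro ⟨t, ⟨h0, h1⟩, rfl⟩
      have : 0 < 1 - t := sub_pos.2 h1
      positivity
    · intro hx
      refine ⟨x / (θ + x), ⟨by positivity, by rw [div_lt_one (by positivity)]; linarith⟩, ?_⟩
      have : 1 - x / (θ + x) = θ / (θ + x) := by
        field_simp
        ring
      rw [this]
      field_simp
  have hinj : Set.InjOn (fun t : ℝ => θ * (t / (1 - t))) (Set.Ioo 0 1) := by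
    intro s hs t ht h
    have h1 : 1 - s ≠ 0 := (sub_pos.2 hs.2).ne'
    have h2 : 1 - t ≠ 0 := (sub_pos.2 ht.2).ne'
    have h3 := mul_left_cancel₀ hθ.ne' h
    rw [div_eq_div_iff h1 h2] at h3
    linarith
  have hderiv : ∀ t ∈ Set.Ioo (0 : ℝ) 1,
      HasDerivWithinAt (fun t : ℝ => θ * (t / (1 - t))) (θ / (1 - t) ^ 2) (Set.Ioo 0 1) t := by
    intro t ht
    have h1 : 1 - t ≠ 0 := (sub_pos.2 ht.2).ne'
    have h := (((hasDerivAt_id t).div ((hasDerivAt_id t).const_sub 1) h1).const_mul θ)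
    refine (h.congr_deriv ?_).hasDerivWithinAt
    simp only [id]
    field_simp
    ring
  have hcongr : Set.EqOn (fun t => |θ / (1 - t) ^ 2| • (Real.logb 2 (1 + θ * (t / (1 - t)))
        * sinrPDF ρ a χ₁ b χ (θ * (t / (1 - t)))))
      (fun t => Real.Gamma (a + b) / (Real.Gamma a * Real.Gamma b * Real.log 2)
        * (betaWeight a b t * Real.log (1 - t * (1 - θ)) - betaWeight a b t * Real.log (1 - t)))
      (Set.Ioo 0 1) := fun t ht => sinrPDF_comp_eq rfl hP hχ ht
  have hi1 := integrableOn_betaWeight_mul_log_one_sub ha hb hθ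
  have hi2 := integrableOn_betaWeight_mul_log ha hb
  constructor
  · rw [← himage, integrableOn_image_iff_integrableOn_abs_deriv_smul measurableSet_Ioo hderiv hinj,
      integrableOn_congr_fun hcongr measurableSet_Ioo]
    exact (hi1.sub hi2).const_mul _
  · rw [achievableRate, ← himage,
      integral_image_eq_integral_abs_deriv_smul measurableSet_Ioo hderiv hinj,
      setIntegral_congr_fun measurableSet_Ioo hcongr, integral_const_mul, integral_sub hi1 hi2]

/-! ### Constants, integration of the connection formula, and the closed form. -/

/-- Both reduce to $\Gamma(b)\Gamma(1-b)=\pi/\sin\pi b$. The first evaluates the constant of the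
connection formula, the second brings the coefficient of the ${}_3F_2$ term to its final shape. -/
theorem gamma_connection_constant {a b : ℝ} (ha : 0 < a) (hb : 0 < b) (hbn : ∀ n : ℕ, b ≠ n) :
    (a + b) * ProbabilityTheory.beta (a + 1) b / (1 - b)
        * (Real.Gamma (2 - b) * Real.Gamma (a + b) / Real.Gamma (1 + a))
      = Real.pi * (Real.sin (b * Real.pi))⁻¹ ∧
    (a + b) * ProbabilityTheory.beta (a + 1) b / (1 - b) * Real.Gamma (a + b)
      = Real.pi * (Real.sin (b * Real.pi))⁻¹ * Real.Gamma (1 + a) / Real.Gamma (2 - b) := by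
  have h1 : 1 - b ≠ 0 := sub_ne_zero.2 fun h => hbn 1 (by simp [← h])
  have h2 : Real.Gamma (2 - b) = (1 - b) * Real.Gamma (1 - b) := by
    rw [← Real.Gamma_add_one h1]
    ring_nf
  have h3 : Real.pi * (Real.sin (b * Real.pi))⁻¹ = Real.Gamma b * Real.Gamma (1 - b) := by
    rw [Real.Gamma_mul_Gamma_one_sub, mul_comm b, div_eq_mul_inv]
  have h4 : Real.Gamma (a + 1 + b) = (a + b) * Real.Gamma (a + b) := by
    rw [← Real.Gamma_add_one (by positivity)]
    ring_nf
  have h5 : Real.Gamma (1 - b) ≠ 0 := by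
    refine Real.Gamma_ne_zero fun n h => hbn (n + 1) ?_
    push_cast
    linarith
  have h6 := (Real.Gamma_pos_of_pos (add_pos ha hb)).ne'
  have h7 := (Real.Gamma_pos_of_pos (add_pos one_pos ha)).ne'
  have h8 : a + b ≠ 0 := (add_pos ha hb).ne'
  rw [ProbabilityTheory.beta, h2, h3, h4, add_comm a 1]
  constructor <;> field_simp

theorem neBot_nhdsWithin_im_neg (x : ℝ) : (𝓝[{z : ℂ | z.im < 0}] (x : ℂ)).NeBot := by
  rw [← mem_closure_iff_nhdsWithin_neBot, Complex.closure_setOfPred_im_lt]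
  simp

/-- The logarithmic Beta integral in terms of solutions of the hypergeometric equations. -/
theorem integral_log_eq_of_branches {a b : ℝ} (ha : 0 < a) (hb : 0 < b) (hbn : ∀ n : ℕ, b ≠ n)
    {F G H : ℂ → ℂ} (hF : DifferentiableOn ℂ F cutPlane) (hG : DifferentiableOn ℂ G cutPlane)
    (hH : DifferentiableOn ℂ H cutPlane)
    (hFd : ∀ z ∈ cutPlane, z * deriv F z + b * F z = b * (1 - z) ^ (-(a + b : ℂ)))
    (hGd : ∀ z ∈ cutPlane, z * deriv G z + G z = H z)
    (hHd : ∀ z ∈ cutPlane, z * (1 - z) * deriv H z = (1 - b) * (1 - H z) + (1 + a) * z * H z)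
    (hHl : Tendsto (fun x : ℝ => (((1 - x) ^ (a + b) : ℝ) : ℂ) * H x) (𝓝[<] 1)
      (𝓝 ((Real.Gamma (2 - b) * Real.Gamma (a + b) / Real.Gamma (1 + a) : ℝ) : ℂ)))
    {z : ℂ} (hz : z ∈ Complex.slitPlane ∩ cutPlane) :
    betaTransform a b (fun w => Complex.log (1 - w)) (1 - z)
      = (∫ t in Set.Ioo (0 : ℝ) 1, betaWeight a b t * Real.log (1 - t) : ℝ)
        + ((Real.pi * (Real.sin (b * Real.pi))⁻¹ / b : ℝ) : ℂ) * (z ^ (b : ℂ) * F z)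
        - (((a + b) * ProbabilityTheory.beta (a + 1) b / (1 - b) : ℝ) : ℂ) * (z * G z) := by
  obtain ⟨K, hK, hKd, hL⟩ := exists_stieltjes ha hb
  have hb1 : b ≠ 1 := by simpa using hbn 1
  have hbC : (b : ℂ) ≠ 0 := by exact_mod_cast hb.ne'
  set A : ℝ := (a + b) * ProbabilityTheory.beta (a + 1) b / (1 - b) with hA
  set C : ℝ := Real.pi * (Real.sin (b * Real.pi))⁻¹ with hC
  have hconn : ∀ z ∈ Complex.slitPlane ∩ cutPlane, K (1 - z) + A * H z
      = C * (z ^ ((b : ℂ) - 1) * (1 - z) ^ (-(a + b : ℂ))) := by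
    intro z hz
    have h := connection_formula ha hb hb1 hK hKd hH hHd hHl hz
    have hC' := (gamma_connection_constant ha hb hbn).1
    rw [← hC, ← hA] at hC'
    rw [← hC', hA]
    push_cast at h ⊢
    exact h
  set L := betaTransform a b fun w => Complex.log (1 - w) with hLdef
  -- By `hconn` and the equations for `F` and `G`, this combination has derivative zero.
  set φ : ℂ → ℂ := fun z => L (1 - z) - (C / b : ℂ) * (z ^ (b : ℂ) * F z) + A * (z * G z) with hφ
  have hderiv : ∀ z ∈ Complex.slitPlane ∩ cutPlane, HasDerivAt φ 0 z := by
    rintro z ⟨hzs, hzc⟩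
    have h1 : HasDerivAt (fun z => L (1 - z)) (K (1 - z)) z := by
      have h' := HasDerivAt.comp z (hL _ (mem_slitPlane_iff_one_sub.1 hzs))
        ((hasDerivAt_id z).const_sub 1)
      simpa [Function.comp_def] using h'
    have h2 : HasDerivAt (fun z : ℂ => z ^ (b : ℂ)) (b * z ^ ((b : ℂ) - 1)) z := by
      simpa using (hasDerivAt_id z).cpow_const (c := (b : ℂ)) hzs
    have h3 := (hF.differentiableAt (isOpen_cutPlane.mem_nhds hzc)).hasDerivAt
    have h4 := (hG.differentiableAt (isOpen_cutPlane.mem_nhds hzc)).hasDerivAt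
    refine ((h1.sub ((h2.mul h3).const_mul (C / b : ℂ))).add
      (((hasDerivAt_id z).mul h4).const_mul (A : ℂ))).congr_deriv ?_
    have hF' := hFd z hzc
    have hG' := hGd z hzc
    have hc' := hconn z ⟨hzs, hzc⟩
    simp only [id]
    rw [← cpow_sub_one_mul_self (b : ℂ) (Complex.slitPlane_ne_zero hzs)]
    field_simp
    linear_combination (b : ℂ) * hc' - C * z ^ ((b : ℂ) - 1) * hF' + A * b * hG'
  have hconst : ∀ w ∈ Complex.slitPlane ∩ cutPlane, φ w = φ z := fun w hw =>
    eqOn_const_of_hasDerivAt_zero isOpen_slitPlane_inter_cutPlane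
      isPreconnected_slitPlane_inter_cutPlane hderiv hw hz
  -- At 0 the terms $z^bF$ and $zG$ vanish, so the constant is $L(1)$. That point is on the cut,
  -- hence the dominated convergence in `tendsto_integral_log`.
  have hlim : Tendsto (fun x : ℝ => φ x) (𝓝[>] 0)
      (𝓝 (∫ t in Set.Ioo (0 : ℝ) 1, betaWeight a b t * Real.log (1 - t) : ℝ)) := by
    have h1 : Tendsto (fun x : ℝ => L (1 - x)) (𝓝[>] 0)
        (𝓝 (∫ t in Set.Ioo (0 : ℝ) 1, betaWeight a b t * Real.log (1 - t) : ℝ)) := by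
      refine ((Complex.continuous_ofReal.tendsto _).comp (tendsto_integral_log ha hb)).congr' ?_
      filter_upwards [self_mem_nhdsWithin] with x hx
      exact (betaTransform_log_ofReal a b hx).symm
    have hcont : ∀ f : ℂ → ℂ, DifferentiableOn ℂ f cutPlane →
        Tendsto (fun x : ℝ => f x) (𝓝[>] 0) (𝓝 (f 0)) := by
      intro f hf
      have h0 : ContinuousAt f ((0 : ℝ) : ℂ) :=
        (hf.differentiableAt (isOpen_cutPlane.mem_nhds (by simp [cutPlane]))).continuousAt
      have h : ContinuousAt (fun x : ℝ => f x) 0 :=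
        ContinuousAt.comp (f := fun x : ℝ => (x : ℂ)) h0 (by fun_prop)
      simpa using h.tendsto.mono_left nhdsWithin_le_nhds
    have h2 : Tendsto (fun x : ℝ => (x : ℂ) ^ (b : ℂ)) (𝓝[>] 0) (𝓝 0) := by
      have h : ContinuousAt (fun x : ℝ => ((x ^ b : ℝ) : ℂ)) 0 :=
        Complex.continuous_ofReal.continuousAt.comp
          (Real.continuous_rpow_const hb.le).continuousAt
      have h' := h.tendsto.mono_left (nhdsWithin_le_nhds (s := Set.Ioi (0 : ℝ)))
      rw [Real.zero_rpow hb.ne', Complex.ofReal_zero] at h'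
      refine h'.congr' ?_
      filter_upwards [self_mem_nhdsWithin] with x hx
      exact Complex.ofReal_cpow (le_of_lt hx) _
    have h3 := hcont id differentiableOn_id
    have h4 := (h1.sub ((h2.mul (hcont F hF)).const_mul (C / b : ℂ))).add
      ((h3.mul (hcont G hG)).const_mul (A : ℂ))
    simpa using h4
  have hval : φ z = (∫ t in Set.Ioo (0 : ℝ) 1, betaWeight a b t * Real.log (1 - t) : ℝ) := by
    refine tendsto_nhds_unique (tendsto_const_nhds.congr' ?_) hlim
    filter_upwards [Ioo_mem_nhdsGT zero_lt_one] with x hx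
    exact (hconst x (ofReal_mem_slitPlane_inter_cutPlane hx.1 hx.2)).symm
  rw [← hval, hφ]
  push_cast
  ring

/-- The logarithmic Beta integral in terms of the values of principal branches. -/
theorem integral_log_eq_principalBranch {a b θ : ℝ} (ha : 0 < a) (hb : 0 < b)
    (hθ : 0 < θ) (hθ1 : θ ≠ 1) {f g F G : ℂ → ℂ}
    (hF : IsPrincipalBranch f F) (hG : IsPrincipalBranch g G) {L₁ C A : ℂ}
    (h : ∀ z ∈ Complex.slitPlane ∩ cutPlane,
      betaTransform a b (fun w => Complex.log (1 - w)) (1 - z)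
        = L₁ + C * (z ^ (b : ℂ) * F z) - A * (z * G z)) :
    betaTransform a b (fun w => Complex.log (1 - w)) (1 - θ)
        = L₁ + C * ((θ : ℂ) ^ (b : ℂ) * F θ) - A * (θ * G θ) := by
  rcases lt_or_gt_of_ne hθ1 with h1 | h1
  · exact h θ (ofReal_mem_slitPlane_inter_cutPlane hθ h1)
  -- For $\theta>1$ the point $1-\theta$ is negative, so the left side is continuous at $\theta$;
  -- the identity passes to the limit from the lower half-plane.
  · obtain ⟨K, -, -, hL⟩ := exists_stieltjes ha hb
    have hne := neBot_nhdsWithin_im_neg θ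
    have hc : ContinuousAt (betaTransform a b fun w => Complex.log (1 - w)) (1 - (θ : ℂ)) :=
      (hL _ (one_sub_ofReal_mem_cutPlane hθ)).continuousAt
    have hc' : ContinuousAt
        (fun z : ℂ => betaTransform a b (fun w => Complex.log (1 - w)) (1 - z)) θ :=
      ContinuousAt.comp (f := fun z : ℂ => 1 - z) hc (by fun_prop)
    have hp : ContinuousAt (fun z : ℂ => z ^ (b : ℂ)) θ :=
      ContinuousAt.cpow continuousAt_id continuousAt_const (Complex.ofReal_mem_slitPlane.2 hθ)
    have hi : ContinuousAt (fun z : ℂ => z) θ := continuousAt_id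
    have hr := ((((hp.tendsto.mono_left nhdsWithin_le_nhds).mul (hF.below θ h1)).const_mul
      C).const_add L₁).sub
      (((hi.tendsto.mono_left nhdsWithin_le_nhds).mul (hG.below θ h1)).const_mul A)
    refine tendsto_nhds_unique (hc'.tendsto.mono_left nhdsWithin_le_nhds) (hr.congr' ?_)
    filter_upwards [self_mem_nhdsWithin] with z hz
    exact (h z ⟨mem_slitPlane_of_im_neg hz, mem_cutPlane_of_im_neg hz⟩).symm

theorem deriv_eq_of_eqOn_cutPlane {f g : ℂ → ℂ} (h : Set.EqOn f g cutPlane) {z : ℂ}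
    (hz : z ∈ cutPlane) : deriv f z = deriv g z :=
  (h.eventuallyEq_of_mem (isOpen_cutPlane.mem_nhds hz)).deriv_eq

theorem achievableRate_eq_rateClosedForm {ρ j₁ χ₁ j₂ χ₂ : ℝ} (hρ : 0 < ρ) (h₁ : 0 < j₁)
    (hχ₁ : 0 < χ₁) (h₂ : 0 < j₂) (hχ₂ : 0 < χ₂) (hn : ∀ n : ℕ, j₂ ≠ n) (hne : ρ * χ₁ ≠ χ₂) :
    IsPrincipalBranch (ordinaryHypergeometric (j₂ : ℂ) (j₁ + j₂ : ℂ) (1 + j₂ : ℂ))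
        (gaussHyp j₂ (j₁ + j₂) (1 + j₂)) ∧
      IsPrincipalBranch (hypSeries [1, 1, 1 + j₁] [2, 2 - j₂])
        (genHyp [1, 1, 1 + j₁] [2, 2 - j₂]) ∧
      (achievableRate ρ j₁ χ₁ j₂ χ₂ : ℂ) = rateClosedForm ρ j₁ χ₁ j₂ χ₂ := by
  obtain ⟨F₀, hF₀, hFs, hFd, hFl⟩ := exists_branch_gauss j₁ h₂
  obtain ⟨G₀, H, hG₀, hH, hGs, hGd, hHd, hGl, hHl⟩ := exists_branch_hypergeometric h₁ h₂ hn
  have hF := isPrincipalBranch_principalBranch (IsPrincipalBranch.of_tendsto hF₀ hFs hFl)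
  have hG := isPrincipalBranch_principalBranch (IsPrincipalBranch.of_tendsto hG₀ hGs hGl)
  refine ⟨hF, hG, ?_⟩
  have hFe := hF.eqOn hF₀ hFs
  have hGe := hG.eqOn hG₀ hGs
  set θ := ρ * χ₁ / χ₂ with hθdef
  have hP : 0 < ρ * χ₁ := mul_pos hρ hχ₁
  have hθ : 0 < θ := div_pos hP hχ₂
  have hθ1 : θ ≠ 1 := by
    rw [hθdef, Ne, div_eq_one_iff_eq hχ₂.ne']
    exact hne
  have hid := integral_log_eq_principalBranch h₁ h₂ hθ hθ1 hF hG
    fun z hz => integral_log_eq_of_branches h₁ h₂ hn hF.holo hG.holo hH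
      (fun z hz => by rw [deriv_eq_of_eqOn_cutPlane hFe hz, hFe hz, hFd z hz])
      (fun z hz => by rw [deriv_eq_of_eqOn_cutPlane hGe hz, hGe hz, hGd z hz]) hHd hHl hz
  rw [betaTransform_log_ofReal j₁ j₂ hθ] at hid
  rw [(rate_change_of_variables hρ h₁ hχ₁ h₂ hχ₂).2, Complex.ofReal_mul, Complex.ofReal_sub,
    ← hθdef, hid, rateClosedForm, gaussHyp, genHyp, ← hθdef]
  have hA := (gamma_connection_constant h₁ h₂ hn).2
  set A := (j₁ + j₂) * ProbabilityTheory.beta (j₁ + 1) j₂ / (1 - j₂) with hAdef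
  have hpow : ((θ : ℂ) ^ (j₂ : ℂ)) = ((ρ * χ₁) ^ j₂ / χ₂ ^ j₂ : ℝ) := by
    rw [← Complex.ofReal_cpow hθ.le, hθdef, Real.div_rpow hP.le hχ₂.le]
  rw [hpow]
  set X := principalBranch (ordinaryHypergeometric (j₂ : ℂ) (j₁ + j₂ : ℂ) (1 + j₂ : ℂ)) θ
  set Y := principalBranch (hypSeries [1, 1, 1 + j₁] [2, 2 - j₂]) θ
  have hg1 := (Real.Gamma_pos_of_pos h₁).ne'
  have hg2 := (Real.Gamma_pos_of_pos h₂).ne'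
  have hl : Real.log 2 ≠ 0 := (Real.log_pos one_lt_two).ne'
  have hχp := (Real.rpow_pos_of_pos hχ₂ j₂).ne'
  -- The factor $1/b$ from integrating $z^{b-1}$ appears in the closed form as
  -- $\Gamma(b)/\Gamma(1+b)$.
  have e1 : Real.Gamma (j₁ + j₂) / (Real.Gamma j₁ * Real.Gamma j₂ * Real.log 2)
      * (Real.pi * (Real.sin (j₂ * Real.pi))⁻¹ / j₂ * ((ρ * χ₁) ^ j₂ / χ₂ ^ j₂))
      = Real.pi * (Real.sin (j₂ * Real.pi))⁻¹ / (Real.Gamma j₁ * Real.Gamma j₂ * Real.log 2)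
        * ((ρ * χ₁) ^ j₂ * Real.Gamma (j₁ + j₂) * Real.Gamma j₂
          / (χ₂ ^ j₂ * Real.Gamma (1 + j₂))) := by
    rw [add_comm 1 j₂, Real.Gamma_add_one h₂.ne']
    field_simp
  have e2 : Real.Gamma (j₁ + j₂) / (Real.Gamma j₁ * Real.Gamma j₂ * Real.log 2) * (A * θ)
      = Real.pi * (Real.sin (j₂ * Real.pi))⁻¹ / (Real.Gamma j₁ * Real.Gamma j₂ * Real.log 2)
        * (ρ * χ₁ * Real.Gamma (1 + j₁) / (χ₂ * Real.Gamma (2 - j₂))) := by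
    rw [hθdef]
    calc _ = A * Real.Gamma (j₁ + j₂) * (ρ * χ₁ / χ₂)
          / (Real.Gamma j₁ * Real.Gamma j₂ * Real.log 2) := by ring
      _ = _ := by
        rw [hA]
        ring
  have e1' := congrArg (fun x : ℝ => (x : ℂ)) e1
  have e2' := congrArg (fun x : ℝ => (x : ℂ)) e2
  simp only [Complex.ofReal_mul (r := _ / (Real.Gamma j₁ * Real.Gamma j₂ * Real.log 2))] at e1' e2'
  rw [Complex.ofReal_mul (Real.pi * (Real.sin (j₂ * Real.pi))⁻¹ / j₂)] at e1'
  rw [Complex.ofReal_mul A] at e2'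
  linear_combination X * e1' - Y * e2'

theorem lemma4 :
    -- the rate of a user of the system, with the parameters that its moments determine
    (∀ (M K N lp : ℕ) (S : CellFreeSystem M K N lp) (k : Fin K), (∃ m, 0 < S.η m k) →
      (0 < S.j1 k ∧ 0 < S.χ1 k ∧ 0 < S.j2 k ∧ 0 < S.χ2 k) ∧
      ((∀ n : ℕ, S.j2 k ≠ n) → S.ρd * S.χ1 k ≠ S.χ2 k →
        (achievableRate S.ρd (S.j1 k) (S.χ1 k) (S.j2 k) (S.χ2 k) : ℂ)
          = rateClosedForm S.ρd (S.j1 k) (S.χ1 k) (S.j2 k) (S.χ2 k))) ∧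
    -- the identity for arbitrary Gamma parameters, with all its terms well defined
    (∀ ρ j₁ χ₁ j₂ χ₂ : ℝ, 0 < ρ → 0 < j₁ → 0 < χ₁ → 0 < j₂ → 0 < χ₂ →
      IntegrableOn (fun x => Real.logb 2 (1 + x) * sinrPDF ρ j₁ χ₁ j₂ χ₂ x) (Set.Ioi 0) ∧
      ((∀ n : ℕ, j₂ ≠ n) → ρ * χ₁ ≠ χ₂ →
        IsPrincipalBranch (ordinaryHypergeometric (j₂ : ℂ) (j₁ + j₂ : ℂ) (1 + j₂ : ℂ))
          (gaussHyp j₂ (j₁ + j₂) (1 + j₂)) ∧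
        IsPrincipalBranch (hypSeries [1, 1, 1 + j₁] [2, 2 - j₂])
          (genHyp [1, 1, 1 + j₁] [2, 2 - j₂]) ∧
        (achievableRate ρ j₁ χ₁ j₂ χ₂ : ℂ) = rateClosedForm ρ j₁ χ₁ j₂ χ₂)) := by
  refine ⟨fun M K N lp S k h => ?_, fun ρ j₁ χ₁ j₂ χ₂ hρ h₁ hχ₁ h₂ hχ₂ =>
    ⟨(rate_change_of_variables hρ h₁ hχ₁ h₂ hχ₂).1,
      fun hn hne => achievableRate_eq_rateClosedForm hρ h₁ hχ₁ h₂ hχ₂ hn hne⟩⟩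
  obtain ⟨h₁, hχ₁, h₂, hχ₂⟩ := S.gamma_parameters_pos h
  exact ⟨⟨h₁, hχ₁, h₂, hχ₂⟩, fun hn hne =>
    (achievableRate_eq_rateClosedForm S.ρd_pos h₁ hχ₁ h₂ hχ₂ hn hne).2.2⟩
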